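/- Let $d\ge 1$, let $\mathbb S$ be the unit sphere of $\mathbb C^d$ with normalised surface measure $\sigma$, and let $H(p,q)$ be the space of restrictions to $\mathbb S$ of the harmonic homogeneous polynomials of degree $p$ in $z_1,\dots,z_d$ and $q$ in $\overline{z_1},\dots,\overline{z_d}$; let $\mathrm{Hom}(p,q)$ be the same without the word harmonic. For a finite set $\tau\subset\mathbb N^2$ put $P_\tau=\sum_{(p,q)\in\tau}H(p,q)$ and $\tau^{\rm rev}=\{(q,p):(p,q)\in\tau\}$, and let $$(p,q)\cdot(r,s)=\{(p+r-j,q+s-j):0\le j\le\min\{p,s\}+\min\{q,r\}\},\qquad \mathcal U\cdot\mathcal V=\bigcup_{a\in\mathcal U,\,b\in\mathcal V}a\cdot b .$$ A sequence $v_1,\dots,v_n\in\mathbb S$ ($n\ge1$) is a design for a space $P$ of functions on $\mathbb S$ if $\int_{\mathbb S}f\,d\sigma=\frac1n\sum_j f(v_j)$ for all $f\in P$, and a $\tau$-design if this holds for $P=P_\tau$; a spherical $(t,t)$-design is a design for $\mathrm{span}\{|\langle\cdot,u\rangle|^{2t}:u\in\mathbb C^d\}$. Its angles are the numbers $\langle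 v_j,v_k\rangle$ with $v_j\ne v_k$. Let $Q_{00}=1$, for $(p,q)\neq(0,0)$ let $$Q_{pq}(z)=\frac{p+q+d-1}{(d-1)!}\sum_{j=0}^{\min\{p,q\}}(-1)^j\frac{(d+p+q-j-2)!}{j!\,(p-j)!\,(q-j)!}\,z^{p-j}\overline z^{\,q-j},$$ and let $Q_{\mathcal E}=\sum_{(p,q)\in\mathcal E}Q_{pq}$. A function $F$ is a potential (with constant) for $P_\tau$ if on the set $\{\langle x,y\rangle:x,y\in\mathbb S\}$ it equals a finite sum $\sum f_{pq}Q_{pq}$ with all $f_{pq}\ge0$ and, for $(p,q)\ne(0,0)$, $f_{pq}>0$ exactly when $(p,q)\in\tau$. **(a)** Let $\mathcal E\subset\mathbb N^2$ be finite and nonempty. Then $F=|Q_{\mathcal E}|^2=Q_{\mathcal E}\,Q_{\mathcal E^{\rm rev}}\ge0$ is a potential for $P_\tau$ for some $\tau\subset\mathcal E\cdot\mathcal E^{\rm rev}$, and for $d\ge3$ it is a potential for $P_{\mathcal E\cdot\mathcal E^{\rm rev}}$ itself. The number $n$ of points of any $(\mathcal E\cdot\mathcal E^{\rm rev})$-design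 satisfies $$n\ \ge\ \dim(P_{\mathcal E})=\sum_{(p,q)\in\mathcal E}\dim H(p,q).$$ If $d\ge2$, or if $d=1$ and some $(p,q)\in\mathcal E$ has $p=0$ or $q=0$ (i.e. $P_{\mathcal E}\ne0$), equality holds if and only if the points are pairwise distinct and all angles of the design are roots of $Q_{\mathcal E}$. **(b)** For all $p,q$, $\sum_{j=0}^{\min\{p,q\}}\dim H(p-j,q-j)=\dim\mathrm{Hom}(p,q)=\binom{p+d-1}{d-1}\binom{q+d-1}{d-1}$, and the number $n$ of points of any spherical $(t,t)$-design for $\mathbb C^d$ with $t=p+q$ satisfies $n\ge\binom{p+d-1}{d-1}\binom{q+d-1}{d-1}$. Among all $p+q=t$ this bound is largest for $p=\lfloor t/2\rfloor$, where it reads $$n\ge\binom{k+d-1}{d-1}^2\ (t=2k),\qquad n\ge\binom{k+d-1}{d-1}\binom{k+d}{d-1}\ (t=2k+1).$$ These bounds are at least $\binom{t+d-1}{d-1}$, and strictly greater if $d\ge2$ and $t\ge2$. -/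

import Mathlib

namespace ComplexDesign

open MeasureTheory

/-- The unit sphere `𝕊` of `ℂ^d` (with the Euclidean norm). -/
abbrev Sphere (d : ℕ) : Type := Metric.sphere (0 : EuclideanSpace ℂ (Fin d)) 1

/-- The normalised surface area measure on the unit sphere of `ℂ^d`: the surface measure
obtained from Lebesgue (additive Haar) measure by polar coordinates, scaled to total mass one. -/
noncomputable def sphereMeasure (d : ℕ) : Measure (Sphere d) :=
  ((Measure.addHaar : Measure (EuclideanSpace ℂ (Fin d))).toSphere Set.univ)⁻¹ •
    (Measure.addHaar : Measure (EuclideanSpace ℂ (Fin d))).toSphere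

/-- Polynomials in the `2d` variables `z_1,…,z_d` (indices `Sum.inl i`) and
`conj z_1,…,conj z_d` (indices `Sum.inr i`). -/
abbrev BiPoly (d : ℕ) : Type := MvPolynomial (Fin d ⊕ Fin d) ℂ

/-- The homogeneous polynomials of bidegree `(p,q)`: degree `p` in the variables `z_i` and
degree `q` in the variables `conj z_i`. -/
noncomputable def homPoly (d p q : ℕ) : Submodule ℂ (BiPoly d) :=
  MvPolynomial.weightedHomogeneousSubmodule ℂ
    (Sum.elim (fun _ => ((1, 0) : ℕ × ℕ)) (fun _ => ((0, 1) : ℕ × ℕ))) (p, q)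

/-- The operator `∑ i, ∂²/∂z_i ∂(conj z_i)`, which is a quarter of the Laplacian of
`ℂ^d = ℝ^(2d)`. -/
noncomputable def laplacian (d : ℕ) : BiPoly d →ₗ[ℂ] BiPoly d :=
  ∑ i : Fin d, (MvPolynomial.pderiv (R := ℂ) (Sum.inl i : Fin d ⊕ Fin d)).toLinearMap ∘ₗ
    (MvPolynomial.pderiv (R := ℂ) (Sum.inr i : Fin d ⊕ Fin d)).toLinearMap

/-- The restriction to the sphere of the function `z ↦ f(z, conj z)` given by `f`. -/
noncomputable def restrictSphere (d : ℕ) : BiPoly d →ₗ[ℂ] (Sphere d → ℂ) :=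
  LinearMap.pi fun x =>
    (MvPolynomial.aeval (R := ℂ)
      (Sum.elim (fun i : Fin d => x.1 i)
        (fun i : Fin d => (starRingEnd ℂ) (x.1 i)))).toLinearMap

/-- `Hom(p,q)`: the restrictions to the sphere of the homogeneous polynomials of bidegree
`(p,q)`. -/
noncomputable def Hom (d p q : ℕ) : Submodule ℂ (Sphere d → ℂ) :=
  (homPoly d p q).map (restrictSphere d)

/-- `H(p,q)`: the restrictions to the sphere of the harmonic homogeneous polynomials of bidegree
`(p,q)`. -/
noncomputable def Harm (d p q : ℕ) : Submodule ℂ (Sphere d → ℂ) :=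
  (homPoly d p q ⊓ LinearMap.ker (laplacian d)).map (restrictSphere d)

/-- `P_τ`: the sum of the spaces `H(p,q)`, `(p,q) ∈ τ`. -/
noncomputable def polySpace (d : ℕ) (τ : Finset (ℕ × ℕ)) : Submodule ℂ (Sphere d → ℂ) :=
  ⨆ i ∈ τ, Harm d i.1 i.2

/-- `Hom_{t,t}`: the span of the functions `|⟨·,u⟩|^(2t)`, `u ∈ ℂ^d`, on the sphere. -/
noncomputable def projSpace (d t : ℕ) : Submodule ℂ (Sphere d → ℂ) :=
  Submodule.span ℂ (Set.range fun (u : EuclideanSpace ℂ (Fin d)) (x : Sphere d) =>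
    ((‖inner ℂ u x.1‖ ^ (2 * t) : ℝ) : ℂ))

/-- The sequence `v_1,…,v_n` (`n ≥ 1`) of points of the sphere is a spherical design (with
constant weights `1/n`) for the space `P` of functions on the sphere. -/
def IsDesign {d n : ℕ} (P : Submodule ℂ (Sphere d → ℂ)) (v : Fin n → Sphere d) : Prop :=
  0 < n ∧ ∀ f ∈ P, ∫ x, f x ∂(sphereMeasure d) = (1 / (n : ℂ)) * ∑ j, f (v j)

/-- The inner product `⟨x,y⟩ = ∑ i, x_i conj(y_i)` of two points of the sphere. -/
noncomputable def ip {d : ℕ} (x y : Sphere d) : ℂ := inner ℂ y.1 x.1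

/-- The angles of a sequence of points: the inner products of its distinct points. -/
def angles {d n : ℕ} (v : Fin n → Sphere d) : Set ℂ :=
  {α | ∃ j k, v j ≠ v k ∧ α = ip (v j) (v k)}

/-- The complex Gegenbauer polynomial `Q_{pq}^{(d)}`, `d ≥ 1`, by its explicit formula. For
`(p,q) = (0,0)` and `d ≥ 2` the general formula gives the constant `1`; for `d = 1` its
coefficient reads `0 · (-1)!`, so that the value `1` is put in separately. -/
noncomputable def gegenbauer (d p q : ℕ) (z : ℂ) : ℂ :=
  if p = 0 ∧ q = 0 then 1
  else ((p + q + d - 1 : ℕ) : ℂ) / ((d - 1).factorial : ℂ) *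
    ∑ j ∈ Finset.range (min p q + 1),
      (-1) ^ j * ((d + p + q - j - 2).factorial : ℂ) /
        ((j.factorial : ℂ) * ((p - j).factorial : ℂ) * ((q - j).factorial : ℂ)) *
          z ^ (p - j) * ((starRingEnd ℂ) z) ^ (q - j)

/-- `Q_E = ∑_{(p,q) ∈ E} Q_{pq}`. -/
noncomputable def gegenbauerSum (d : ℕ) (E : Finset (ℕ × ℕ)) (z : ℂ) : ℂ :=
  ∑ i ∈ E, gegenbauer d i.1 i.2 z

/-- `E^rev = {(q,p) : (p,q) ∈ E}`. -/
def rev (E : Finset (ℕ × ℕ)) : Finset (ℕ × ℕ) := E.image Prod.swap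

/-- The product of two indices, `(p,q)·(r,s) = {(p+r-j, q+s-j) : 0 ≤ j ≤ μ}` with
`μ = min(p,s) + min(q,r)`. -/
def indexMul (a b : ℕ × ℕ) : Finset (ℕ × ℕ) :=
  (Finset.range (min a.1 b.2 + min a.2 b.1 + 1)).image
    fun j => (a.1 + b.1 - j, a.2 + b.2 - j)

/-- The product `E·F = ⋃_{a ∈ E, b ∈ F} a·b` of two sets of indices. -/
def setMul (E F : Finset (ℕ × ℕ)) : Finset (ℕ × ℕ) :=
  E.biUnion fun a => F.biUnion fun b => indexMul a b

/-- `F` gives a potential (possibly with a constant term) for `P_τ`: on the inner products of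
points of the sphere, `F = ∑ f_{pq} Q_{pq}` is a finite sum with all `f_{pq} ≥ 0`, and `τ` is,
up to the index `(0,0)` of the constants, the set of the `(p,q)` with `f_{pq} > 0`. -/
def IsPotential (d : ℕ) (F : ℂ → ℂ) (τ : Finset (ℕ × ℕ)) : Prop :=
  ∃ f : (ℕ × ℕ) →₀ ℝ, (∀ i, 0 ≤ f i) ∧
    (∀ x y : Sphere d,
      F (ip x y) = ∑ i ∈ f.support, (f i : ℂ) * gegenbauer d i.1 i.2 (ip x y)) ∧
    ∀ i, i ≠ (0, 0) → (0 < f i ↔ i ∈ τ)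

end ComplexDesign

/-!
Polynomials in `z` and `conj z` are treated as polynomials in `2d` independent variables. The
Laplacian `Δ = ∑ ∂²/∂z_i ∂(conj z_i)` gives the decomposition of a bihomogeneous polynomial into
`|z|^{2j}` times harmonic ones (`exists_harmonic_decomposition`), hence the dimensions of
`Hom(p,q)` and `H(p,q)`. It also computes integrals over the sphere: by unitary invariance the
mean of `|⟨z,u⟩|^{2k}` is a multiple of `‖u‖^{2k}`, these polynomials span the bidegree `(k,k)`
(`homPoly_le_span`), and so the mean of a polynomial `f` of bidegree `(k,k)` is a fixed multiple of
the constant `Δ^k f` (`sphereIntegral_eq`).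

In the Laplacian of a product of two harmonic polynomials only pairings of a variable of one factor
with a conjugate variable of the other one survive. This shows that the spaces `H(p,q)` are
orthogonal, that `H(p,q) H(r,s)` lies in the sum of the `H(i)` with `i` in `(p,q)·(r,s)`
(`mul_mem_polySpace`), and that `Q_{pq}(⟨x,y⟩)` is the reproducing kernel of `H(p,q)`
(`integral_mul_conj_zonal`). So `Q_{pq}(1) = dim H(p,q)`, and `Q_E(⟨x,y⟩)` is the
reproducing kernel of `P_E`.

The coefficient of `Q_i` in `Q_a Q_b`, multiplied by `dim H(i)`, is the sum of the numbers
`|∫ e e' conj(e'')|²` over orthonormal bases of `H(a)`, `H(b)`, `H(i)` and hence nonnegative. It is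
positive when `H(a) H(b)` is not orthogonal to `H(i)`; for `d ≥ 3` suitable products of powers of
linear forms show this for all admissible `i` (`exists_mul_not_orthogonal`). This expands `|Q_E|²`
with nonnegative coefficients (`exists_potential`).

For a design of `n` points `v_j` and `N = dim P_E`, integrating the function `|Q_E(⟨·,v_k⟩)|²` gives
`n N = ∑_j |Q_E(⟨v_j,v_k⟩)|²`. The term `j = k` alone is `N²`, which yields `n ≥ N`, and equality
holds exactly when all the terms with `j ≠ k` vanish (`IsDesign.le_and_eq_iff`). For a spherical
`(p+q,p+q)`-design the functions `|f|²` with `f` in `Hom(p,q)` are integrated exactly, so that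
evaluation at the points is injective on `Hom(p,q)` (`IsDesign.finrank_Hom_le`).
-/

namespace ComplexDesign

open MeasureTheory
open scoped Pointwise

variable {d : ℕ}

/-! ### The algebra of the Laplacian on bihomogeneous polynomials -/

lemma homPoly_mul {p q r s : ℕ} {f g : BiPoly d} (hf : f ∈ homPoly d p q)
    (hg : g ∈ homPoly d r s) : f * g ∈ homPoly d (p + r) (q + s) :=
  MvPolynomial.IsWeightedHomogeneous.mul hf hg

lemma homPoly_one : (1 : BiPoly d) ∈ homPoly d 0 0 :=
  MvPolynomial.isWeightedHomogeneous_one ℂ _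

lemma homPoly_pow {p q : ℕ} {f : BiPoly d} (hf : f ∈ homPoly d p q) (n : ℕ) :
    f ^ n ∈ homPoly d (n * p) (n * q) := by
  have := MvPolynomial.IsWeightedHomogeneous.pow hf n
  simpa [homPoly] using this

lemma X_inl_mem (i : Fin d) : (MvPolynomial.X (Sum.inl i) : BiPoly d) ∈ homPoly d 1 0 :=
  MvPolynomial.isWeightedHomogeneous_X ℂ _ _

lemma X_inr_mem (i : Fin d) : (MvPolynomial.X (Sum.inr i) : BiPoly d) ∈ homPoly d 0 1 :=
  MvPolynomial.isWeightedHomogeneous_X ℂ _ _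

lemma pderiv_inl_mem {p q : ℕ} {f : BiPoly d} (hf : f ∈ homPoly d (p + 1) q) (i : Fin d) :
    MvPolynomial.pderiv (Sum.inl i) f ∈ homPoly d p q :=
  MvPolynomial.IsWeightedHomogeneous.pderiv hf (by simp)

lemma pderiv_inr_mem {p q : ℕ} {f : BiPoly d} (hf : f ∈ homPoly d p (q + 1)) (i : Fin d) :
    MvPolynomial.pderiv (Sum.inr i) f ∈ homPoly d p q :=
  MvPolynomial.IsWeightedHomogeneous.pderiv hf (by simp)

lemma pderiv_inl_eq_zero {q : ℕ} {f : BiPoly d} (hf : f ∈ homPoly d 0 q) (i : Fin d) :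
    MvPolynomial.pderiv (Sum.inl i) f = 0 := by
  ext m
  rw [MvPolynomial.coeff_pderiv, MvPolynomial.IsWeightedHomogeneous.coeff_eq_zero hf]
  · simp
  · simp [map_add, Finsupp.weight_single, Prod.ext_iff]

lemma pderiv_inr_eq_zero {p : ℕ} {f : BiPoly d} (hf : f ∈ homPoly d p 0) (i : Fin d) :
    MvPolynomial.pderiv (Sum.inr i) f = 0 := by
  ext m
  rw [MvPolynomial.coeff_pderiv, MvPolynomial.IsWeightedHomogeneous.coeff_eq_zero hf]
  · simp
  · simp [map_add, Finsupp.weight_single, Prod.ext_iff]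

lemma laplacian_apply (f : BiPoly d) : laplacian d f =
    ∑ i : Fin d, MvPolynomial.pderiv (Sum.inl i) (MvPolynomial.pderiv (Sum.inr i) f) := by
  simp [laplacian]

lemma pderiv_comm (i j : Fin d ⊕ Fin d) (f : BiPoly d) :
    MvPolynomial.pderiv i (MvPolynomial.pderiv j f) =
      MvPolynomial.pderiv j (MvPolynomial.pderiv i f) := by
  have h : ⁅MvPolynomial.pderiv (R := ℂ) i, MvPolynomial.pderiv (R := ℂ) j⁆ = 0 := by
    apply MvPolynomial.derivation_ext
    intro k
    classical
    rw [Derivation.commutator_apply]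
    simp only [MvPolynomial.pderiv_X, Pi.single_apply]
    split_ifs <;> simp
  have := congrArg (fun D => D f) h
  simpa [Derivation.commutator_apply, sub_eq_zero] using this

lemma laplacian_mem {p q : ℕ} {f : BiPoly d} (hf : f ∈ homPoly d (p + 1) (q + 1)) :
    laplacian d f ∈ homPoly d p q := by
  rw [laplacian_apply]
  exact Submodule.sum_mem _ fun i _ => pderiv_inl_mem (pderiv_inr_mem hf i) i

lemma laplacian_pderiv (i : Fin d ⊕ Fin d) (f : BiPoly d) :
    laplacian d (MvPolynomial.pderiv i f) = MvPolynomial.pderiv i (laplacian d f) := by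
  rw [laplacian_apply, laplacian_apply, map_sum]
  refine Finset.sum_congr rfl fun j _ => ?_
  rw [pderiv_comm (Sum.inr j) i, pderiv_comm (Sum.inl j) i]

lemma laplacian_mul (f g : BiPoly d) : laplacian d (f * g) =
    laplacian d f * g + f * laplacian d g +
      ∑ i : Fin d, (MvPolynomial.pderiv (Sum.inl i) f * MvPolynomial.pderiv (Sum.inr i) g +
        MvPolynomial.pderiv (Sum.inr i) f * MvPolynomial.pderiv (Sum.inl i) g) := by
  simp only [laplacian_apply, Finset.sum_mul, Finset.mul_sum, ← Finset.sum_add_distrib]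
  refine Finset.sum_congr rfl fun i _ => ?_
  simp only [MvPolynomial.pderiv_mul, map_add]
  ring

/-- The harmonic homogeneous polynomials of bidegree `(p,q)`. -/
noncomputable def harmPoly (d p q : ℕ) : Submodule ℂ (BiPoly d) :=
  homPoly d p q ⊓ LinearMap.ker (laplacian d)

lemma Harm_eq (p q : ℕ) : Harm d p q = (harmPoly d p q).map (restrictSphere d) := rfl

lemma mem_harmPoly {p q : ℕ} {f : BiPoly d} :
    f ∈ harmPoly d p q ↔ f ∈ homPoly d p q ∧ laplacian d f = 0 := Iff.rfl

lemma harmPoly.laplacian_eq {p q : ℕ} {f : BiPoly d} (hf : f ∈ harmPoly d p q) :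
    laplacian d f = 0 := hf.2

lemma harmPoly_pderiv_inl {p q : ℕ} {f : BiPoly d} (hf : f ∈ harmPoly d (p + 1) q) (i : Fin d) :
    MvPolynomial.pderiv (Sum.inl i) f ∈ harmPoly d p q :=
  mem_harmPoly.2 ⟨pderiv_inl_mem hf.1 i, by
    rw [laplacian_pderiv, harmPoly.laplacian_eq hf, map_zero]⟩

lemma harmPoly_pderiv_inr {p q : ℕ} {f : BiPoly d} (hf : f ∈ harmPoly d p (q + 1)) (i : Fin d) :
    MvPolynomial.pderiv (Sum.inr i) f ∈ harmPoly d p q :=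
  mem_harmPoly.2 ⟨pderiv_inr_mem hf.1 i, by
    rw [laplacian_pderiv, harmPoly.laplacian_eq hf, map_zero]⟩

lemma laplacian_eq_zero_of_left {q : ℕ} {f : BiPoly d} (hf : f ∈ homPoly d 0 q) :
    laplacian d f = 0 := by
  rw [laplacian_apply]
  refine Finset.sum_eq_zero fun i _ => ?_
  rw [pderiv_comm, pderiv_inl_eq_zero hf, map_zero]

lemma laplacian_eq_zero_of_right {p : ℕ} {f : BiPoly d} (hf : f ∈ homPoly d p 0) :
    laplacian d f = 0 := by
  rw [laplacian_apply]
  refine Finset.sum_eq_zero fun i _ => ?_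
  rw [pderiv_inr_eq_zero hf, map_zero]

lemma laplacian_iterate_mem (k : ℕ) {p q : ℕ} {f : BiPoly d}
    (hf : f ∈ homPoly d (p + k) (q + k)) : (laplacian d ^ k) f ∈ homPoly d p q := by
  induction k generalizing f with
  | zero => simpa using hf
  | succ k ih => rw [pow_succ]; exact ih (laplacian_mem hf)

lemma laplacian_iterate_eq_zero {p q : ℕ} {f : BiPoly d} (hf : f ∈ homPoly d p q) :
    (laplacian d ^ (min p q + 1)) f = 0 := by
  rw [pow_succ']
  rcases le_total p q with h | h
  · obtain ⟨b, rfl⟩ := Nat.exists_eq_add_of_le h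
    rw [min_eq_left h]
    exact laplacian_eq_zero_of_left (q := b)
      (laplacian_iterate_mem p (by simpa [add_comm] using hf))
  · obtain ⟨b, rfl⟩ := Nat.exists_eq_add_of_le h
    rw [min_eq_right h]
    exact laplacian_eq_zero_of_right (p := b)
      (laplacian_iterate_mem q (by simpa [add_comm] using hf))

/-- The polynomial `∑ i, z_i conj(z_i)`, equal to `1` on the sphere. -/
noncomputable def normSqPoly (d : ℕ) : BiPoly d :=
  ∑ i : Fin d, MvPolynomial.X (Sum.inl i) * MvPolynomial.X (Sum.inr i)

lemma normSqPoly_mem : normSqPoly d ∈ homPoly d 1 1 :=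
  Submodule.sum_mem _ fun i _ => homPoly_mul (X_inl_mem i) (X_inr_mem i)

lemma normSqPoly_pow_mul_mem {p q : ℕ} {f : BiPoly d} (hf : f ∈ homPoly d p q) (k : ℕ) :
    normSqPoly d ^ k * f ∈ homPoly d (p + k) (q + k) := by
  have := homPoly_mul (homPoly_pow normSqPoly_mem k) hf
  simpa [add_comm] using this

lemma euler_inl {p q : ℕ} {f : BiPoly d} (hf : f ∈ homPoly d p q) :
    ∑ i : Fin d, MvPolynomial.X (Sum.inl i) * MvPolynomial.pderiv (Sum.inl i) f =
      (p : BiPoly d) * f := by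
  have h : MvPolynomial.IsWeightedHomogeneous
      (Sum.elim (fun _ => 1) (fun _ => 0) : Fin d ⊕ Fin d → ℕ) f p := by
    intro m hm
    have := congrArg Prod.fst (hf hm)
    dsimp only at this
    rw [← this, Finsupp.weight_apply, Finsupp.weight_apply, Finsupp.sum_fintype _ _ (by simp),
      Finsupp.sum_fintype _ _ (by simp)]
    simp [Prod.fst_sum]
  have := h.sum_weight_X_mul_pderiv
  simpa using this

lemma euler_inr {p q : ℕ} {f : BiPoly d} (hf : f ∈ homPoly d p q) :
    ∑ i : Fin d, MvPolynomial.X (Sum.inr i) * MvPolynomial.pderiv (Sum.inr i) f =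
      (q : BiPoly d) * f := by
  have h : MvPolynomial.IsWeightedHomogeneous
      (Sum.elim (fun _ => 0) (fun _ => 1) : Fin d ⊕ Fin d → ℕ) f q := by
    intro m hm
    have := congrArg Prod.snd (hf hm)
    dsimp only at this
    rw [← this, Finsupp.weight_apply, Finsupp.weight_apply, Finsupp.sum_fintype _ _ (by simp),
      Finsupp.sum_fintype _ _ (by simp)]
    simp [Prod.snd_sum]
  have := h.sum_weight_X_mul_pderiv
  simpa using this

lemma pderiv_inl_normSqPoly (i : Fin d) :
    MvPolynomial.pderiv (Sum.inl i) (normSqPoly d) = MvPolynomial.X (Sum.inr i) := by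
  classical
  simp [normSqPoly, MvPolynomial.pderiv_X, Pi.single_apply]

lemma pderiv_inr_normSqPoly (i : Fin d) :
    MvPolynomial.pderiv (Sum.inr i) (normSqPoly d) = MvPolynomial.X (Sum.inl i) := by
  classical
  simp [normSqPoly, MvPolynomial.pderiv_X, Pi.single_apply]

lemma laplacian_normSqPoly_mul {p q : ℕ} {f : BiPoly d} (hf : f ∈ homPoly d p q) :
    laplacian d (normSqPoly d * f) =
      ((d + p + q : ℕ) : BiPoly d) * f + normSqPoly d * laplacian d f := by
  have h : laplacian d (normSqPoly d) = (d : BiPoly d) := by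
    simp [laplacian_apply, pderiv_inr_normSqPoly]
  rw [laplacian_mul, h, Finset.sum_add_distrib]
  simp only [pderiv_inl_normSqPoly, pderiv_inr_normSqPoly, euler_inl hf, euler_inr hf]
  push_cast
  ring

lemma laplacian_normSqPoly_pow_mul (k : ℕ) {p q : ℕ} {f : BiPoly d} (hf : f ∈ homPoly d p q) :
    laplacian d (normSqPoly d ^ (k + 1) * f) =
      (((k + 1) * (d + p + q + k) : ℕ) : BiPoly d) * (normSqPoly d ^ k * f) +
        normSqPoly d ^ (k + 1) * laplacian d f := by
  induction k with
  | zero => simpa using laplacian_normSqPoly_mul hf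
  | succ k ih =>
    rw [pow_succ', mul_assoc, laplacian_normSqPoly_mul (normSqPoly_pow_mul_mem hf (k + 1)), ih]
    push_cast
    ring

lemma laplacian_normSqPoly_pow_mul_harm (k : ℕ) {p q : ℕ} {f : BiPoly d}
    (hf : f ∈ harmPoly d p q) :
    laplacian d (normSqPoly d ^ (k + 1) * f) =
      (((k + 1) * (d + p + q + k) : ℕ) : ℂ) • (normSqPoly d ^ k * f) := by
  rw [laplacian_normSqPoly_pow_mul k hf.1, harmPoly.laplacian_eq hf, mul_zero, add_zero,
    MvPolynomial.smul_eq_C_mul]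
  simp

/-- For harmonic `f` of bidegree `(p,q)`, applying the Laplacian `k` times undoes the
multiplication by `|z|^{2k}`, up to a factor which is not zero when `d ≥ 1`. -/
lemma laplacian_iterate_normSqPoly_pow_mul (k : ℕ) {p q : ℕ} {f : BiPoly d}
    (hf : f ∈ harmPoly d p q) :
    (laplacian d ^ k) (normSqPoly d ^ k * f) =
      ((∏ i ∈ Finset.range k, ((i + 1) * (d + p + q + i)) : ℕ) : ℂ) • f := by
  induction k with
  | zero => simp
  | succ k ih =>
    rw [pow_succ, Module.End.mul_apply, laplacian_normSqPoly_pow_mul_harm k hf, map_smul, ih,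
      smul_smul, Finset.prod_range_succ]
    congr 1
    push_cast
    ring

lemma laplacian_iterate_normSqPoly_pow_mul_of_lt {j k : ℕ} (hjk : j < k) {p q : ℕ} {f : BiPoly d}
    (hf : f ∈ harmPoly d p q) : (laplacian d ^ k) (normSqPoly d ^ j * f) = 0 := by
  obtain ⟨m, rfl⟩ := Nat.exists_eq_add_of_lt hjk
  rw [show j + m + 1 = m + (1 + j) by ring, pow_add, pow_add, Module.End.mul_apply,
    Module.End.mul_apply, laplacian_iterate_normSqPoly_pow_mul j hf, map_smul, pow_one,
    harmPoly.laplacian_eq hf, smul_zero, map_zero]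

/-- The decomposition `f = ∑ |z|^{2j} h_j` of a bihomogeneous polynomial into harmonic ones; if
`Δ^k f = 0` then only the terms with `j < k` occur. -/
lemma exists_harmonic_decomposition (hd : 1 ≤ d) (k : ℕ) {p q : ℕ} (hp : k ≤ p + 1)
    (hq : k ≤ q + 1) {f : BiPoly d} (hf : f ∈ homPoly d p q) (hk : (laplacian d ^ k) f = 0) :
    ∃ h : ℕ → BiPoly d, (∀ j < k, h j ∈ harmPoly d (p - j) (q - j)) ∧
      f = ∑ j ∈ Finset.range k, normSqPoly d ^ j * h j := by
  induction k generalizing f with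
  | zero => exact ⟨0, by simp, by simpa using hk⟩
  | succ k ih =>
    obtain ⟨a, rfl⟩ := Nat.exists_eq_add_of_le' (Nat.le_of_succ_le_succ hp)
    obtain ⟨b, rfl⟩ := Nat.exists_eq_add_of_le' (Nat.le_of_succ_le_succ hq)
    have hg : (laplacian d ^ k) f ∈ harmPoly d a b :=
      mem_harmPoly.2 ⟨laplacian_iterate_mem k hf, by rw [← Module.End.mul_apply, ← pow_succ', hk]⟩
    set c : ℂ := ((∏ i ∈ Finset.range k, ((i + 1) * (d + a + b + i)) : ℕ) : ℂ) with hc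
    have hc0 : c ≠ 0 := by
      rw [hc, Nat.cast_ne_zero, Finset.prod_ne_zero_iff]
      intro i _
      positivity
    set g := c⁻¹ • (laplacian d ^ k) f with hgdef
    have hg' : g ∈ harmPoly d a b := Submodule.smul_mem _ _ hg
    obtain ⟨h, hh, hsum⟩ := ih (f := f - normSqPoly d ^ k * g) (by omega) (by omega)
      (Submodule.sub_mem _ hf (normSqPoly_pow_mul_mem hg'.1 k)) (by
        rw [map_sub, laplacian_iterate_normSqPoly_pow_mul k hg', ← hc, hgdef, smul_smul,
          mul_inv_cancel₀ hc0, one_smul, sub_self])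
    refine ⟨fun j => if j = k then g else h j, ?_, ?_⟩
    · intro j hj
      by_cases hjk : j = k
      · subst hjk
        simpa using hg'
      · simpa [hjk] using hh j (by omega)
    · rw [Finset.sum_range_succ, ← sub_eq_iff_eq_add]
      simp only [if_true]
      rw [hsum]
      refine Finset.sum_congr rfl fun j hj => ?_
      rw [if_neg (Finset.mem_range.1 hj).ne]

lemma exists_laplacian_eq (hd : 1 ≤ d) {p q : ℕ} {f : BiPoly d} (hf : f ∈ homPoly d p q) :
    ∃ g ∈ homPoly d (p + 1) (q + 1), laplacian d g = f := by
  obtain ⟨h, hh, hsum⟩ := exists_harmonic_decomposition hd (min p q + 1) (by simp) (by simp) hf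
    (laplacian_iterate_eq_zero hf)
  refine ⟨∑ j ∈ Finset.range (min p q + 1),
    (((j + 1) * (d + (p - j) + (q - j) + j) : ℕ) : ℂ)⁻¹ • (normSqPoly d ^ (j + 1) * h j), ?_, ?_⟩
  · refine Submodule.sum_mem _ fun j hj => Submodule.smul_mem _ _ ?_
    have hj' := Finset.mem_range.1 hj
    have := normSqPoly_pow_mul_mem (hh j hj').1 (j + 1)
    rwa [show p - j + (j + 1) = p + 1 by omega, show q - j + (j + 1) = q + 1 by omega] at this
  · rw [hsum, map_sum]
    refine Finset.sum_congr rfl fun j hj => ?_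
    rw [map_smul, laplacian_normSqPoly_pow_mul_harm j (hh j (Finset.mem_range.1 hj)), smul_smul,
      inv_mul_cancel₀, one_smul]
    rw [Nat.cast_ne_zero]
    positivity

/-- In the product of harmonic polynomials the Laplacian only pairs a `z` of one factor with a
`conj z` of the other one, so that sufficiently many Laplacians annihilate it. -/
lemma laplacian_iterate_mul_eq_zero (k : ℕ) {p q r s : ℕ} {f g : BiPoly d}
    (hf : f ∈ harmPoly d p q) (hg : g ∈ harmPoly d r s) (hk : min p s + min q r < k) :
    (laplacian d ^ k) (f * g) = 0 := by
  induction k generalizing p q r s f g with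
  | zero => simp at hk
  | succ k ih =>
    rw [pow_succ, Module.End.mul_apply, laplacian_mul, harmPoly.laplacian_eq hf,
      harmPoly.laplacian_eq hg, zero_mul, mul_zero, zero_add, zero_add, map_sum]
    refine Finset.sum_eq_zero fun i _ => ?_
    rw [map_add]
    have h1 : (laplacian d ^ k)
        (MvPolynomial.pderiv (Sum.inl i) f * MvPolynomial.pderiv (Sum.inr i) g) = 0 := by
      rcases p with _ | p
      · rw [pderiv_inl_eq_zero hf.1, zero_mul, map_zero]
      rcases s with _ | s
      · rw [pderiv_inr_eq_zero hg.1, mul_zero, map_zero]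
      exact ih (harmPoly_pderiv_inl hf i) (harmPoly_pderiv_inr hg i) (by omega)
    have h2 : (laplacian d ^ k)
        (MvPolynomial.pderiv (Sum.inr i) f * MvPolynomial.pderiv (Sum.inl i) g) = 0 := by
      rcases q with _ | q
      · rw [pderiv_inr_eq_zero hf.1, zero_mul, map_zero]
      rcases r with _ | r
      · rw [pderiv_inl_eq_zero hg.1, mul_zero, map_zero]
      exact ih (harmPoly_pderiv_inr hf i) (harmPoly_pderiv_inl hg i) (by omega)
    rw [h1, h2, add_zero]

/-! ### Evaluation at points and at conjugate pairs -/

/-- The value of a polynomial in the variables `z_i` and `conj z_i` at independent values of the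
two groups of variables. -/
noncomputable def bieval (z w : Fin d → ℂ) : BiPoly d →ₐ[ℂ] ℂ :=
  MvPolynomial.aeval (Sum.elim z w)

@[simp] lemma bieval_X_inl (z w : Fin d → ℂ) (i : Fin d) :
    bieval z w (MvPolynomial.X (Sum.inl i)) = z i := by simp [bieval]

@[simp] lemma bieval_X_inr (z w : Fin d → ℂ) (i : Fin d) :
    bieval z w (MvPolynomial.X (Sum.inr i)) = w i := by simp [bieval]

lemma restrictSphere_apply (f : BiPoly d) (x : Sphere d) :
    restrictSphere d f x = bieval (fun i => x.1 i) (fun i => (starRingEnd ℂ) (x.1 i)) f := rfl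

/-- Bihomogeneity in terms of values. -/
lemma bieval_mul_mul_of_mem_homPoly {p q : ℕ} {f : BiPoly d} (hf : f ∈ homPoly d p q)
    (z w : Fin d → ℂ) (a b : ℂ) :
    bieval (fun i => a * z i) (fun i => b * w i) f = a ^ p * b ^ q * bieval z w f := by
  rw [bieval, bieval, MvPolynomial.aeval_def, MvPolynomial.aeval_def, MvPolynomial.eval₂_eq,
    MvPolynomial.eval₂_eq, Finset.mul_sum]
  refine Finset.sum_congr rfl fun m hm => ?_
  have hw := hf (MvPolynomial.mem_support_iff.1 hm)
  have h1 := congrArg Prod.fst hw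
  have h2 := congrArg Prod.snd hw
  dsimp only at h1 h2
  rw [Finsupp.weight_apply, Finsupp.sum_fintype _ _ (by simp)] at h1 h2
  simp [Prod.fst_sum, Prod.snd_sum] at h1 h2
  rw [← h1, ← h2, ← Finset.prod_pow_eq_pow_sum, ← Finset.prod_pow_eq_pow_sum]
  have key : ∀ z w : Fin d → ℂ, ∏ i ∈ m.support, (Sum.elim z w i) ^ m i =
      (∏ i, z i ^ m (Sum.inl i)) * ∏ i, w i ^ m (Sum.inr i) := by
    intro z w
    rw [← Finsupp.prod, Finsupp.prod_fintype _ _ (by simp), Fintype.prod_sum_type]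
    simp
  rw [key, key]
  simp only [mul_pow, Finset.prod_mul_distrib]
  ring

/-- A polynomial in `z` and `conj z` which vanishes as a function of `z` is zero. -/
lemma eq_zero_of_forall_bieval_conj {f : BiPoly d}
    (h : ∀ z : Fin d → ℂ, bieval z (fun i => (starRingEnd ℂ) (z i)) f = 0) : f = 0 := by
  -- the substitution `z = x + iy`, `conj z = x - iy` makes `f` a polynomial `g` which vanishes at
  -- all real `x` and `y`, and hence at all complex ones
  set g : BiPoly d := MvPolynomial.aeval (Sum.elim
    (fun i => MvPolynomial.X (Sum.inl i) + MvPolynomial.C Complex.I * MvPolynomial.X (Sum.inr i))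
    (fun i => MvPolynomial.X (Sum.inl i) - MvPolynomial.C Complex.I * MvPolynomial.X (Sum.inr i)))
    f with hg
  have heval : ∀ v : Fin d ⊕ Fin d → ℂ, MvPolynomial.eval v g =
      bieval (fun i => v (Sum.inl i) + Complex.I * v (Sum.inr i))
        (fun i => v (Sum.inl i) - Complex.I * v (Sum.inr i)) f := by
    intro v
    have : (MvPolynomial.aeval v).comp (MvPolynomial.aeval (Sum.elim
        (fun i => MvPolynomial.X (Sum.inl i) +
          MvPolynomial.C Complex.I * MvPolynomial.X (Sum.inr i))
        (fun i => MvPolynomial.X (Sum.inl i) -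
          MvPolynomial.C Complex.I * MvPolynomial.X (Sum.inr i)))
          : BiPoly d →ₐ[ℂ] BiPoly d) =
        bieval (fun i => v (Sum.inl i) + Complex.I * v (Sum.inr i))
          (fun i => v (Sum.inl i) - Complex.I * v (Sum.inr i)) := by
      apply MvPolynomial.algHom_ext
      rintro (i | i) <;> simp
    have := congrArg (fun F => F f) this
    simpa [hg, MvPolynomial.aeval_eq_eval] using this
  have hg0 : g = 0 := by
    refine MvPolynomial.funext_set (fun _ => Set.range ((↑) : ℝ → ℂ))
      (fun _ => Set.infinite_range_of_injective Complex.ofReal_injective) fun v hv => ?_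
    rw [map_zero, heval]
    choose y hy using fun i => hv i (Set.mem_univ i)
    convert h (fun i => v (Sum.inl i) + Complex.I * v (Sum.inr i)) using 3
    funext i
    rw [← hy, ← hy]
    simp [sub_eq_add_neg]
  apply MvPolynomial.funext
  intro v
  have h1 := heval (Sum.elim (fun i => (v (Sum.inl i) + v (Sum.inr i)) / 2)
    (fun i => (v (Sum.inl i) - v (Sum.inr i)) / (2 * Complex.I)))
  rw [hg0, map_zero] at h1
  rw [map_zero, h1, ← MvPolynomial.coe_aeval_eq_eval, bieval]
  have : v = Sum.elim (fun i => v (Sum.inl i)) (fun i => v (Sum.inr i)) := by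
    ext (i | i) <;> rfl
  conv_lhs => rw [this]
  have h2 : ∀ a : ℂ, Complex.I * (a / (2 * Complex.I)) = a / 2 := by
    intro a
    field_simp
  simp only [Sum.elim_inl, Sum.elim_inr, h2]
  have h3 : ∀ a b : ℂ, (a + b) / 2 + (a - b) / 2 = a := by intros; ring
  have h4 : ∀ a b : ℂ, (a + b) / 2 - (a - b) / 2 = b := by intros; ring
  simp only [h3, h4]
  rfl

/-- A bihomogeneous polynomial is determined by its values on the sphere. -/
lemma eq_zero_of_restrictSphere_eq_zero (hd : 1 ≤ d) {p q : ℕ} {f : BiPoly d}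
    (hf : f ∈ homPoly d p q) (h : restrictSphere d f = 0) : f = 0 := by
  have hne : ∀ z : EuclideanSpace ℂ (Fin d), z ≠ 0 →
      bieval (fun i => z i) (fun i => (starRingEnd ℂ) (z i)) f = 0 := by
    intro z hz
    have hn : (‖z‖ : ℂ) ≠ 0 := by simpa using hz
    have hx : ((‖z‖⁻¹ : ℝ) : ℂ) • z ∈ Metric.sphere (0 : EuclideanSpace ℂ (Fin d)) 1 := by
      simp [norm_smul, hz]
    have h0 := congrFun h ⟨_, hx⟩
    rw [restrictSphere_apply, Pi.zero_apply] at h0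
    have := bieval_mul_mul_of_mem_homPoly hf
      (fun i => (((‖z‖⁻¹ : ℝ) : ℂ) • z) i)
      (fun i => (starRingEnd ℂ) ((((‖z‖⁻¹ : ℝ) : ℂ) • z) i)) (‖z‖ : ℂ) (‖z‖ : ℂ)
    rw [h0, mul_zero] at this
    rw [← this]
    congr 2
    all_goals
      funext i
      simp [hn]
  apply eq_zero_of_forall_bieval_conj
  intro z
  by_cases hz : z = 0
  · by_cases hpq : p = 0 ∧ q = 0
    · -- a constant has the same value at the origin and at a nonzero point
      obtain ⟨rfl, rfl⟩ := hpq
      have h1 := bieval_mul_mul_of_mem_homPoly hf (fun _ => 1) (fun _ => (starRingEnd ℂ) 1) 0 0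
      have h2 := hne (WithLp.toLp 2 fun _ => 1) (by
        intro h0
        have := congrArg (fun v : EuclideanSpace ℂ (Fin d) => v ⟨0, hd⟩) h0
        simp at this)
      simp only at h2
      rw [h2] at h1
      subst hz
      simp only [pow_zero, mul_one, map_zero, map_one, Pi.zero_apply] at h1 ⊢
      exact h1.trans (mul_zero 1)
    · have h1 := bieval_mul_mul_of_mem_homPoly hf 0 0 0 0
      have h2 : (0 : ℂ) ^ p * 0 ^ q = 0 := by
        rcases not_and_or.1 hpq with h | h <;> simp [h]
      rw [h2, zero_mul] at h1
      subst hz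
      simp only [Pi.zero_apply, mul_zero, map_zero] at h1 ⊢
      exact h1
  · have := hne (WithLp.toLp 2 z) (by simpa using hz)
    simpa using this

/-! ### Dimensions -/

/-- The exponent of the monomial `z^k conj(z)^l`. -/
noncomputable def biexp (k l : Fin d → ℕ) : Fin d ⊕ Fin d →₀ ℕ :=
  Finsupp.equivFunOnFinite.symm (Sum.elim k l)

lemma weight_biexp (m : Fin d ⊕ Fin d →₀ ℕ) :
    Finsupp.weight (Sum.elim (fun _ => ((1, 0) : ℕ × ℕ)) (fun _ => ((0, 1) : ℕ × ℕ))) m =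
      (∑ i, m (Sum.inl i), ∑ i, m (Sum.inr i)) := by
  rw [Finsupp.weight_apply, Finsupp.sum_fintype _ _ (by simp)]
  ext <;> simp [Prod.fst_sum, Prod.snd_sum]

/-- The exponents of the monomials of degree `p` in `d` variables. -/
noncomputable def exponents (d p : ℕ) : Finset (Fin d →₀ ℕ) := Finset.finsuppAntidiag Finset.univ p

lemma card_exponents (hd : 1 ≤ d) (p : ℕ) :
    (exponents d p).card = (p + d - 1).choose (d - 1) := by
  rw [exponents, Finset.card_finsuppAntidiag_nat_eq_choose, Finset.card_univ, Fintype.card_fin,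
    ← Nat.choose_symm (by omega)]
  congr 1 <;> omega

/-- The exponents of the monomials of bidegree `(p,q)` are the pairs of exponents of monomials of
the degrees `p` and `q`. -/
noncomputable def exponentEquiv (d p q : ℕ) :
    {m : Fin d ⊕ Fin d →₀ ℕ | Finsupp.weight
      (Sum.elim (fun _ => ((1, 0) : ℕ × ℕ)) (fun _ => ((0, 1) : ℕ × ℕ))) m = (p, q)} ≃
    exponents d p × exponents d q :=
  (Finsupp.sumFinsuppEquivProdFinsupp.subtypeEquiv
    (q := fun c => c.1 ∈ exponents d p ∧ c.2 ∈ exponents d q) (fun m => by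
    rw [Set.mem_ofPred, weight_biexp]
    simp [exponents, Finsupp.sumFinsuppEquivProdFinsupp, Prod.ext_iff]
    exact Iff.rfl)).trans
    Equiv.subtypeProdEquivProd

/-- The coordinates of a polynomial of bidegree `(p,q)` with respect to the monomials. -/
noncomputable def homPolyEquiv (d p q : ℕ) :
    homPoly d p q ≃ₗ[ℂ] (exponents d p × exponents d q →₀ ℂ) :=
  (LinearEquiv.ofEq _ _
    (MvPolynomial.weightedHomogeneousSubmodule_eq_finsupp_supported ℂ _ _)).trans
    ((AddMonoidAlgebra.supportedEquivFinsupp _).trans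
      (Finsupp.domLCongr (exponentEquiv d p q)))

instance (p q : ℕ) : FiniteDimensional ℂ (homPoly d p q) :=
  Module.Finite.equiv (homPolyEquiv d p q).symm

lemma finrank_homPoly (hd : 1 ≤ d) (p q : ℕ) : Module.finrank ℂ (homPoly d p q) =
    (p + d - 1).choose (d - 1) * (q + d - 1).choose (d - 1) := by
  rw [(homPolyEquiv d p q).finrank_eq, Module.finrank_finsupp_self, Fintype.card_prod,
    Fintype.card_coe, Fintype.card_coe, card_exponents hd, card_exponents hd]

instance (p q : ℕ) : FiniteDimensional ℂ (harmPoly d p q) :=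
  Submodule.finiteDimensional_of_le inf_le_left

instance (p q : ℕ) : FiniteDimensional ℂ (Hom d p q) := by
  unfold Hom; infer_instance

instance (p q : ℕ) : FiniteDimensional ℂ (Harm d p q) := by
  rw [Harm_eq]; infer_instance

lemma finrank_map_restrictSphere (hd : 1 ≤ d) {p q : ℕ} {V : Submodule ℂ (BiPoly d)}
    (hV : V ≤ homPoly d p q) :
    Module.finrank ℂ (V.map (restrictSphere d)) = Module.finrank ℂ V := by
  have hinj : Function.Injective ((restrictSphere d).domRestrict V) := by
    rw [← LinearMap.ker_eq_bot, LinearMap.ker_eq_bot']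
    intro f hf
    exact Subtype.ext (eq_zero_of_restrictSphere_eq_zero hd (hV f.2) hf)
  have := LinearMap.finrank_range_of_inj hinj
  rwa [LinearMap.range_domRestrict] at this

lemma finrank_Hom (hd : 1 ≤ d) (p q : ℕ) : Module.finrank ℂ (Hom d p q) =
    (p + d - 1).choose (d - 1) * (q + d - 1).choose (d - 1) := by
  rw [Hom, finrank_map_restrictSphere hd le_rfl, finrank_homPoly hd]

lemma finrank_Harm_eq (hd : 1 ≤ d) (p q : ℕ) :
    Module.finrank ℂ (Harm d p q) = Module.finrank ℂ (harmPoly d p q) := by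
  rw [Harm_eq]
  exact finrank_map_restrictSphere hd inf_le_left

/-- Rank-nullity for the surjective Laplacian from bidegree `(p+1,q+1)` to bidegree `(p,q)`. -/
lemma finrank_harmPoly_add (hd : 1 ≤ d) (p q : ℕ) :
    Module.finrank ℂ (harmPoly d (p + 1) (q + 1)) + Module.finrank ℂ (homPoly d p q) =
      Module.finrank ℂ (homPoly d (p + 1) (q + 1)) := by
  have h := LinearMap.finrank_range_add_finrank_ker
    ((laplacian d).domRestrict (homPoly d (p + 1) (q + 1)))
  rw [LinearMap.range_domRestrict, LinearMap.ker_domRestrict] at h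
  have h1 : (homPoly d (p + 1) (q + 1)).map (laplacian d) = homPoly d p q := by
    apply le_antisymm
    · rintro _ ⟨f, hf, rfl⟩
      exact laplacian_mem hf
    · intro f hf
      exact exists_laplacian_eq hd hf
  have h2 : Module.finrank ℂ ((LinearMap.ker (laplacian d)).comap
      (homPoly d (p + 1) (q + 1)).subtype) = Module.finrank ℂ (harmPoly d (p + 1) (q + 1)) := by
    rw [harmPoly, ← Submodule.map_comap_subtype]
    exact (Submodule.equivMapOfInjective _ (Submodule.subtype_injective _) _).finrank_eq
  rw [h1, h2] at h
  rw [← h, add_comm]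

lemma sum_finrank_Harm (hd : 1 ≤ d) (p q : ℕ) :
    ∑ j ∈ Finset.range (min p q + 1), Module.finrank ℂ (Harm d (p - j) (q - j)) =
      Module.finrank ℂ (Hom d p q) := by
  simp only [finrank_Harm_eq hd]
  rw [Hom, finrank_map_restrictSphere hd le_rfl]
  induction p generalizing q with
  | zero =>
    have : harmPoly d 0 q = homPoly d 0 q :=
      inf_eq_left.2 fun f hf => laplacian_eq_zero_of_left hf
    rw [← this]
    simp
  | succ p ih =>
    rcases q with _ | q
    · have : harmPoly d (p + 1) 0 = homPoly d (p + 1) 0 :=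
        inf_eq_left.2 fun f hf => laplacian_eq_zero_of_right hf
      rw [← this]
      simp
    · rw [← finrank_harmPoly_add hd, ← ih q, Finset.sum_range_succ', Nat.succ_min_succ, add_comm]
      refine congrArg₂ _ rfl (Finset.sum_congr rfl fun j _ => ?_)
      rw [Nat.succ_sub_succ, Nat.succ_sub_succ]

/-! ### Powers of linear forms -/

/-- The linear form `∑ a_i z_i`. -/
noncomputable def zForm (a : Fin d → ℂ) : BiPoly d :=
  ∑ i, MvPolynomial.C (a i) * MvPolynomial.X (Sum.inl i)

/-- The linear form `∑ b_i conj(z_i)`. -/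
noncomputable def zbarForm (b : Fin d → ℂ) : BiPoly d :=
  ∑ i, MvPolynomial.C (b i) * MvPolynomial.X (Sum.inr i)

lemma C_mul_mem {p q : ℕ} {f : BiPoly d} (hf : f ∈ homPoly d p q) (c : ℂ) :
    MvPolynomial.C c * f ∈ homPoly d p q := by
  rw [← MvPolynomial.smul_eq_C_mul]
  exact Submodule.smul_mem _ _ hf

lemma zForm_mem (a : Fin d → ℂ) : zForm a ∈ homPoly d 1 0 :=
  Submodule.sum_mem _ fun i _ => C_mul_mem (X_inl_mem i) _

lemma zbarForm_mem (b : Fin d → ℂ) : zbarForm b ∈ homPoly d 0 1 :=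
  Submodule.sum_mem _ fun i _ => C_mul_mem (X_inr_mem i) _

lemma forms_pow_mem (a b : Fin d → ℂ) (p q : ℕ) :
    zForm a ^ p * zbarForm b ^ q ∈ homPoly d p q := by
  simpa using homPoly_mul (homPoly_pow (zForm_mem a) p) (homPoly_pow (zbarForm_mem b) q)

lemma bieval_zForm (a z w : Fin d → ℂ) : bieval z w (zForm a) = ∑ i, a i * z i := by
  simp [zForm, bieval]

lemma bieval_zbarForm (b z w : Fin d → ℂ) : bieval z w (zbarForm b) = ∑ i, b i * w i := by
  simp [zbarForm, bieval]

lemma monomial_biexp (k l : Fin d → ℕ) (c : ℂ) : MvPolynomial.monomial (biexp k l) c =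
    MvPolynomial.C c * ((∏ i, MvPolynomial.X (Sum.inl i) ^ k i) *
      ∏ i, MvPolynomial.X (Sum.inr i) ^ l i) := by
  rw [MvPolynomial.monomial_eq, Finsupp.prod_fintype _ _ (by simp), Fintype.prod_sum_type]
  simp [biexp]

open Finset in
lemma forms_pow_eq (a b : Fin d → ℂ) (p q : ℕ) : zForm a ^ p * zbarForm b ^ q =
    ∑ k ∈ piAntidiag univ p, ∑ l ∈ piAntidiag univ q, MvPolynomial.monomial (biexp k l)
      ((Nat.multinomial univ k * Nat.multinomial univ l : ℂ) *
        ((∏ i, a i ^ k i) * ∏ i, b i ^ l i)) := by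
  rw [zForm, zbarForm, sum_pow_eq_sum_piAntidiag, sum_pow_eq_sum_piAntidiag, sum_mul_sum]
  refine sum_congr rfl fun k _ => sum_congr rfl fun l _ => ?_
  rw [monomial_biexp]
  simp only [mul_pow, prod_mul_distrib, map_mul, map_prod, map_pow, map_natCast]
  ring

open Finset in
/-- The polynomials `|⟨z,u⟩|^{2t}` span the polynomials of bidegree `(t,t)`: a linear functional
which vanishes on all of them is a polynomial in `u` and `conj u` which vanishes
identically, and its coefficients are the values of the functional on the monomials. -/
lemma homPoly_le_span (t : ℕ) : homPoly d t t ≤ Submodule.span ℂ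
    (Set.range fun u : Fin d → ℂ =>
      zForm (fun i => (starRingEnd ℂ) (u i)) ^ t * zbarForm u ^ t) := by
  intro f hf
  by_contra hcon
  obtain ⟨φ, hφ, hle⟩ := Submodule.exists_le_ker_of_notMem hcon
  apply hφ
  set P : BiPoly d := ∑ k ∈ piAntidiag univ t, ∑ l ∈ piAntidiag univ t,
    MvPolynomial.monomial (biexp l k) ((Nat.multinomial univ k * Nat.multinomial univ l : ℂ) *
      φ (MvPolynomial.monomial (biexp k l) 1)) with hP
  have hP0 : P = 0 := by
    apply eq_zero_of_forall_bieval_conj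
    intro u
    have h0 : φ (zForm (fun i => (starRingEnd ℂ) (u i)) ^ t * zbarForm u ^ t) = 0 :=
      hle (Submodule.subset_span ⟨u, rfl⟩)
    rw [forms_pow_eq, map_sum] at h0
    rw [← h0, hP, map_sum]
    refine sum_congr rfl fun k _ => ?_
    rw [map_sum, map_sum]
    refine sum_congr rfl fun l _ => ?_
    rw [← mul_one ((Nat.multinomial univ k * Nat.multinomial univ l : ℂ) * (_ * _)),
      ← smul_eq_mul (_ * (_ * _)) (1 : ℂ), ← MvPolynomial.smul_monomial, map_smul, monomial_biexp]
    simp [bieval]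
    ring
  have hmon : ∀ k l : Fin d → ℕ, ∑ i, k i = t → ∑ i, l i = t →
      φ (MvPolynomial.monomial (biexp k l) 1) = 0 := by
    intro k l hk hl
    have h0 := congrArg (MvPolynomial.coeff (biexp l k)) hP0
    have hinj : ∀ k' l' : Fin d → ℕ, biexp l' k' = biexp l k ↔ k' = k ∧ l' = l := by
      intro k' l'
      simp only [biexp, EmbeddingLike.apply_eq_iff_eq]
      rw [Sum.elim_eq_iff]
      tauto
    rw [hP, MvPolynomial.coeff_sum, sum_eq_single k, MvPolynomial.coeff_sum, sum_eq_single l,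
      MvPolynomial.coeff_monomial, if_pos rfl, MvPolynomial.coeff_zero] at h0
    · have h1 : ∀ k : Fin d → ℕ, (Nat.multinomial univ k : ℂ) ≠ 0 := fun k =>
        Nat.cast_ne_zero.2 (Nat.multinomial_pos _ _).ne'
      simpa [h1] using h0
    · intro l' _ hne
      rw [MvPolynomial.coeff_monomial, if_neg]
      simp [hinj, hne]
    · simp [mem_piAntidiag, hl]
    · intro k' _ hne
      rw [MvPolynomial.coeff_sum]
      refine sum_eq_zero fun l' _ => ?_
      rw [MvPolynomial.coeff_monomial, if_neg]
      simp [hinj, hne]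
    · simp [mem_piAntidiag, hk]
  rw [MvPolynomial.as_sum f, map_sum]
  refine sum_eq_zero fun m hm => ?_
  have hw := hf (MvPolynomial.mem_support_iff.1 hm)
  rw [weight_biexp, Prod.ext_iff] at hw
  have hmb : m = biexp (fun i => m (Sum.inl i)) (fun i => m (Sum.inr i)) := by
    ext (i | i) <;> rfl
  rw [← mul_one (MvPolynomial.coeff m f), ← smul_eq_mul, ← MvPolynomial.smul_monomial, map_smul,
    hmb, hmon _ _ hw.1 hw.2, smul_zero]

/-! ### The invariant measure on the sphere -/

lemma sphere_nonempty (hd : 1 ≤ d) : Nonempty (Sphere d) :=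
  ⟨⟨EuclideanSpace.single ⟨0, hd⟩ 1, by simp⟩⟩

lemma isProbabilityMeasure_sphereMeasure (hd : 1 ≤ d) :
    IsProbabilityMeasure (sphereMeasure d) := by
  have : Nontrivial (EuclideanSpace ℂ (Fin d)) := by
    have : Nonempty (Fin d) := ⟨⟨0, hd⟩⟩
    infer_instance
  constructor
  rw [sphereMeasure, Measure.smul_apply, smul_eq_mul]
  refine ENNReal.inv_mul_cancel ?_ (measure_ne_top _ _)
  rw [Ne, Measure.measure_univ_eq_zero]
  exact Measure.toSphere_ne_zero _

lemma isOpenPosMeasure_sphereMeasure : (sphereMeasure d).IsOpenPosMeasure := by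
  constructor
  intro U hU hne
  rw [sphereMeasure, Measure.smul_apply, smul_eq_mul]
  refine mul_ne_zero (ENNReal.inv_ne_zero.2 (measure_ne_top _ _)) ?_
  exact hU.measure_ne_zero _ hne

/-- The action on the sphere of a unitary transformation. -/
noncomputable def sphereMap (U : EuclideanSpace ℂ (Fin d) ≃ₗᵢ[ℂ] EuclideanSpace ℂ (Fin d)) :
    Sphere d ≃ₜ Sphere d where
  toFun x := ⟨U x.1, by simp⟩
  invFun x := ⟨U.symm x.1, by simp⟩
  left_inv x := by simp
  right_inv x := by simp
  continuous_toFun := by fun_prop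
  continuous_invFun := by fun_prop

lemma measurePreserving_addHaar
    (U : EuclideanSpace ℂ (Fin d) ≃ₗᵢ[ℂ] EuclideanSpace ℂ (Fin d)) :
    MeasurePreserving U (Measure.addHaar : Measure (EuclideanSpace ℂ (Fin d)))
      (Measure.addHaar : Measure (EuclideanSpace ℂ (Fin d))) := by
  refine ⟨U.continuous.measurable, ?_⟩
  set μ : Measure (EuclideanSpace ℂ (Fin d)) := Measure.addHaar
  have h0 : (Measure.map U μ).IsAddHaarMeasure :=
    U.toContinuousLinearEquiv.isAddHaarMeasure_map μ
  have h1 := Measure.isAddLeftInvariant_eq_smul (Measure.map U μ) μ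
  -- both measures give the same mass to the unit ball
  have h2 : Measure.map U μ (Metric.ball 0 1) = μ (Metric.ball 0 1) := by
    rw [Measure.map_apply U.continuous.measurable Metric.isOpen_ball.measurableSet]
    congr 1
    ext z
    simp
  have h3 : μ (Metric.ball 0 1) ≠ 0 := (Metric.measure_ball_pos μ 0 one_pos).ne'
  have h4 : μ (Metric.ball 0 1) ≠ ⊤ := measure_ball_lt_top.ne
  set c := (Measure.map U μ).addHaarScalarFactor μ
  rw [h1, Measure.smul_apply, ENNReal.smul_def, smul_eq_mul] at h2
  have h5 : (c : ENNReal) = 1 := by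
    rw [← ENNReal.mul_left_inj h3 h4, h2, one_mul]
  rw [h1, ENNReal.coe_eq_one.1 h5, one_smul]

lemma measurePreserving_sphereMap
    (U : EuclideanSpace ℂ (Fin d) ≃ₗᵢ[ℂ] EuclideanSpace ℂ (Fin d)) :
    MeasurePreserving (sphereMap U) (sphereMeasure d) (sphereMeasure d) := by
  refine ⟨(sphereMap U).measurable, ?_⟩
  rw [sphereMeasure, Measure.map_smul]
  congr 1
  ext s hs
  rw [Measure.map_apply (sphereMap U).measurable hs, Measure.toSphere_apply' _ hs,
    Measure.toSphere_apply' _ ((sphereMap U).measurable hs)]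
  congr 1
  rw [← (measurePreserving_addHaar U).measure_preimage_emb
    U.toHomeomorph.measurableEmbedding
    (Set.Ioo (0 : ℝ) 1 • ((↑) '' s : Set (EuclideanSpace ℂ (Fin d))))]
  congr 1
  ext z
  simp only [Set.mem_smul, Set.mem_image, Set.mem_preimage]
  constructor
  · rintro ⟨a, ha, _, ⟨x, hx, rfl⟩, rfl⟩
    exact ⟨a, ha, _, ⟨_, hx, rfl⟩, (U.toLinearEquiv.toLinearMap.map_smul_of_tower a x.1).symm⟩
  · rintro ⟨a, ha, _, ⟨x, hx, rfl⟩, h⟩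
    refine ⟨a, ha, _, ⟨(sphereMap U).symm x, by simpa using hx, rfl⟩, U.injective ?_⟩
    rw [← h]
    have := U.toLinearEquiv.toLinearMap.map_smul_of_tower a ((sphereMap U).symm x).1
    refine this.trans ?_
    congr 1
    exact congrArg Subtype.val ((sphereMap U).apply_symm_apply x)

lemma integral_sphereMap (U : EuclideanSpace ℂ (Fin d) ≃ₗᵢ[ℂ] EuclideanSpace ℂ (Fin d))
    (f : Sphere d → ℂ) :
    ∫ x, f (sphereMap U x) ∂(sphereMeasure d) = ∫ x, f x ∂(sphereMeasure d) :=
  (measurePreserving_sphereMap U).integral_comp (sphereMap U).measurableEmbedding f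

/-- The unitary group acts transitively on the sphere. -/
lemma exists_unitary_map_eq (x y : Sphere d) :
    ∃ U : EuclideanSpace ℂ (Fin d) ≃ₗᵢ[ℂ] EuclideanSpace ℂ (Fin d), U x.1 = y.1 := by
  have hx : ‖x.1‖ = 1 := by simp
  have hy : ‖y.1‖ = 1 := by simp
  let L : Submodule.span ℂ {x.1} →ₗᵢ[ℂ] EuclideanSpace ℂ (Fin d) :=
    (LinearIsometry.toSpanSingleton ℂ _ hy).comp
      (LinearIsometryEquiv.toSpanUnitSingleton x.1 hx).symm.toLinearIsometry
  refine ⟨L.extend.toLinearIsometryEquiv rfl, ?_⟩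
  have h1 := L.extend_apply ⟨x.1, Submodule.mem_span_singleton_self _⟩
  have h2 : (LinearIsometryEquiv.toSpanUnitSingleton x.1 hx).symm
      ⟨x.1, Submodule.mem_span_singleton_self _⟩ = (1 : ℂ) := by
    rw [LinearIsometryEquiv.symm_apply_eq]
    simp
  rw [LinearIsometry.coe_toLinearIsometryEquiv]
  refine h1.trans ?_
  simp [L, h2]

lemma continuous_restrictSphere (f : BiPoly d) : Continuous (restrictSphere d f) := by
  have : restrictSphere d f = fun x : Sphere d => MvPolynomial.eval
      (Sum.elim (fun i => x.1 i) (fun i => (starRingEnd ℂ) (x.1 i))) f := by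
    funext x
    rw [restrictSphere_apply, bieval, MvPolynomial.aeval_eq_eval]
  rw [this]
  refine (MvPolynomial.continuous_eval f).comp (continuous_pi ?_)
  rintro (i | i)
  · simp only [Sum.elim_inl]; fun_prop
  · simp only [Sum.elim_inr]; fun_prop

lemma integrable_of_continuous {f : Sphere d → ℂ} (hf : Continuous f) :
    Integrable f (sphereMeasure d) := by
  have : IsFiniteMeasure (sphereMeasure d) := by
    rcases Nat.eq_zero_or_pos d with rfl | hd
    · constructor
      have : IsEmpty (Sphere 0) := ⟨fun x => by
        have := x.2
        rw [mem_sphere_zero_iff_norm, Subsingleton.elim x.1 0, norm_zero] at this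
        exact zero_ne_one this⟩
      simp [Set.univ_eq_empty_iff.2 this]
    · have := isProbabilityMeasure_sphereMeasure hd
      infer_instance
  exact hf.integrable_of_hasCompactSupport (HasCompactSupport.of_compactSpace f)

/-- The integral over the sphere as a linear functional on polynomials. -/
noncomputable def sphereIntegral (d : ℕ) : BiPoly d →ₗ[ℂ] ℂ where
  toFun f := ∫ x, restrictSphere d f x ∂(sphereMeasure d)
  map_add' f g := by
    rw [map_add]
    exact integral_add (integrable_of_continuous (continuous_restrictSphere f))
      (integrable_of_continuous (continuous_restrictSphere g))
  map_smul' c f := by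
    rw [map_smul]
    exact integral_const_mul c _

lemma restrictSphere_mul (f g : BiPoly d) :
    restrictSphere d (f * g) = restrictSphere d f * restrictSphere d g := by
  funext x
  simp [restrictSphere_apply]

lemma restrictSphere_normSqPoly : restrictSphere d (normSqPoly d) = 1 := by
  funext x
  have h : ‖x.1‖ = 1 := by simp
  rw [EuclideanSpace.norm_eq, Real.sqrt_eq_one] at h
  have h' := congrArg (fun r : ℝ => (r : ℂ)) h
  rw [restrictSphere_apply, normSqPoly, map_sum, Pi.one_apply]
  simpa [Complex.mul_conj, Complex.normSq_eq_norm_sq] using h'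

lemma restrictSphere_normSqPoly_pow_mul (k : ℕ) (f : BiPoly d) :
    restrictSphere d (normSqPoly d ^ k * f) = restrictSphere d f := by
  induction k with
  | zero => simp
  | succ k ih =>
    rw [pow_succ', mul_assoc, restrictSphere_mul, restrictSphere_normSqPoly, one_mul, ih]

/-- Integration over the sphere kills the polynomials of bidegree `(p,q)`, `p ≠ q`, as a scalar
rotation by the angle `π/(p-q)` changes their sign. -/
lemma sphereIntegral_eq_zero {p q : ℕ} (hpq : p ≠ q) {f : BiPoly d} (hf : f ∈ homPoly d p q) :
    sphereIntegral d f = 0 := by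
  set θ : ℝ := Real.pi / ((p : ℝ) - q) with hθ
  have hpq' : (p : ℝ) - q ≠ 0 := sub_ne_zero.2 (Nat.cast_injective.ne hpq)
  set c : ℂ := Complex.exp (θ * Complex.I) with hc
  have hcn : ‖c‖ = 1 := Complex.norm_exp_ofReal_mul_I θ
  have hc0 : c ≠ 0 := Complex.exp_ne_zero _
  have hcc : c ^ p * (starRingEnd ℂ c) ^ q = -1 := by
    have : starRingEnd ℂ c = Complex.exp (-(θ * Complex.I)) := by
      rw [hc, ← Complex.exp_conj]
      simp
    rw [this, hc, ← Complex.exp_nat_mul, ← Complex.exp_nat_mul, ← Complex.exp_add,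
      ← Complex.exp_pi_mul_I]
    congr 1
    have h : ((p : ℝ) - q) * θ = Real.pi := by rw [hθ]; field_simp
    have h' := congrArg (fun r : ℝ => (r : ℂ)) h
    push_cast at h'
    rw [← h']
    ring
  let U : EuclideanSpace ℂ (Fin d) ≃ₗᵢ[ℂ] EuclideanSpace ℂ (Fin d) :=
    { LinearEquiv.smulOfNeZero ℂ _ c hc0 with
      norm_map' := fun z => by
        change ‖c • z‖ = ‖z‖
        rw [norm_smul, hcn, one_mul] }
  have hU : ∀ x : Sphere d, restrictSphere d f (sphereMap U x) = - restrictSphere d f x := by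
    intro x
    rw [restrictSphere_apply, restrictSphere_apply, ← neg_one_mul, ← hcc,
      ← bieval_mul_mul_of_mem_homPoly hf]
    have : ∀ i, (sphereMap U x).1 i = c * x.1 i := fun i => rfl
    simp only [this, map_mul]
  have h := integral_sphereMap U (restrictSphere d f)
  simp only [hU, integral_neg] at h
  change ∫ x, restrictSphere d f x ∂(sphereMeasure d) = 0
  exact self_eq_neg.1 h.symm

lemma inner_eq_sum (u x : EuclideanSpace ℂ (Fin d)) :
    inner ℂ u x = ∑ i, (starRingEnd ℂ) (u i) * x i := by
  rw [PiLp.inner_apply]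
  refine Finset.sum_congr rfl fun i _ => ?_
  rw [RCLike.inner_apply, mul_comm]

/-- The polynomial `|⟨z,u⟩|^{2t}` restricts to the function of that name. -/
lemma restrictSphere_forms_pow (u : Fin d → ℂ) (t : ℕ) (x : Sphere d) :
    restrictSphere d (zForm (fun i => (starRingEnd ℂ) (u i)) ^ t * zbarForm u ^ t) x =
      ((‖inner ℂ (WithLp.toLp 2 u : EuclideanSpace ℂ (Fin d)) x.1‖ ^ (2 * t) : ℝ) : ℂ) := by
  rw [restrictSphere_apply, map_mul, map_pow, map_pow, bieval_zForm, bieval_zbarForm, ← mul_pow,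
    pow_mul, Complex.ofReal_pow, ← Complex.normSq_eq_norm_sq, ← Complex.mul_conj, inner_eq_sum]
  simp

/-- The constant term of a polynomial, that is, its value at the origin. -/
noncomputable def constTerm (d : ℕ) : BiPoly d →ₗ[ℂ] ℂ := (bieval (d := d) 0 0).toLinearMap

/-! ### Integration of polynomials through the Laplacian -/

lemma pderiv_inl_zForm (a : Fin d → ℂ) (i : Fin d) :
    MvPolynomial.pderiv (Sum.inl i) (zForm a) = MvPolynomial.C (a i) := by
  classical
  simp [zForm, MvPolynomial.pderiv_X, Pi.single_apply]

lemma pderiv_inr_zForm (a : Fin d → ℂ) (i : Fin d) :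
    MvPolynomial.pderiv (Sum.inr i) (zForm a) = 0 := pderiv_inr_eq_zero (zForm_mem a) i

lemma pderiv_inr_zbarForm (b : Fin d → ℂ) (i : Fin d) :
    MvPolynomial.pderiv (Sum.inr i) (zbarForm b) = MvPolynomial.C (b i) := by
  classical
  simp [zbarForm, MvPolynomial.pderiv_X, Pi.single_apply]

lemma pderiv_inl_zbarForm (b : Fin d → ℂ) (i : Fin d) :
    MvPolynomial.pderiv (Sum.inl i) (zbarForm b) = 0 := pderiv_inl_eq_zero (zbarForm_mem b) i

lemma pderiv_inl_forms (a b : Fin d → ℂ) (m n : ℕ) (i : Fin d) :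
    MvPolynomial.pderiv (Sum.inl i) (zForm a ^ m * zbarForm b ^ n) =
      MvPolynomial.C (m * a i) * (zForm a ^ (m - 1) * zbarForm b ^ n) := by
  rw [MvPolynomial.pderiv_mul, MvPolynomial.pderiv_pow, MvPolynomial.pderiv_pow, pderiv_inl_zForm,
    pderiv_inl_zbarForm, map_mul, map_natCast]
  ring

lemma pderiv_inr_forms (a b : Fin d → ℂ) (m n : ℕ) (i : Fin d) :
    MvPolynomial.pderiv (Sum.inr i) (zForm a ^ m * zbarForm b ^ n) =
      MvPolynomial.C (n * b i) * (zForm a ^ m * zbarForm b ^ (n - 1)) := by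
  rw [MvPolynomial.pderiv_mul, MvPolynomial.pderiv_pow, MvPolynomial.pderiv_pow, pderiv_inr_zForm,
    pderiv_inr_zbarForm, map_mul, map_natCast]
  ring

lemma laplacian_forms (a b : Fin d → ℂ) (m n : ℕ) :
    laplacian d (zForm a ^ m * zbarForm b ^ n) =
      MvPolynomial.C (m * n * ∑ i, a i * b i) * (zForm a ^ (m - 1) * zbarForm b ^ (n - 1)) := by
  rw [laplacian_apply]
  simp only [pderiv_inr_forms, MvPolynomial.pderiv_C_mul, pderiv_inl_forms]
  rw [Finset.mul_sum, map_sum, Finset.sum_mul]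
  refine Finset.sum_congr rfl fun i _ => ?_
  simp only [map_mul]
  ring

lemma laplacian_iterate_forms (a b : Fin d → ℂ) (k : ℕ) :
    (laplacian d ^ k) (zForm a ^ k * zbarForm b ^ k) =
      MvPolynomial.C ((k.factorial : ℂ) ^ 2 * (∑ i, a i * b i) ^ k) := by
  induction k with
  | zero => simp
  | succ k ih =>
    rw [pow_succ (laplacian d), Module.End.mul_apply, laplacian_forms, ← MvPolynomial.smul_eq_C_mul,
      map_smul]
    simp only [Nat.add_sub_cancel]
    rw [ih, MvPolynomial.smul_eq_C_mul, ← map_mul, Nat.factorial_succ]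
    congr 1
    push_cast
    ring

/-- By unitary invariance the mean of `|⟨z,u⟩|^{2k}` over the sphere is proportional
to `‖u‖^{2k}`. -/
lemma exists_integral_norm_inner_pow (hd : 1 ≤ d) (k : ℕ) :
    ∃ c : ℂ, ∀ u : EuclideanSpace ℂ (Fin d),
      ∫ x : Sphere d, ((‖inner ℂ u x.1‖ ^ (2 * k) : ℝ) : ℂ) ∂(sphereMeasure d) =
        (‖u‖ : ℂ) ^ (2 * k) * c := by
  obtain ⟨e⟩ := sphere_nonempty hd
  refine ⟨∫ x : Sphere d, ((‖inner ℂ e.1 x.1‖ ^ (2 * k) : ℝ) : ℂ) ∂(sphereMeasure d), fun u => ?_⟩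
  obtain ⟨y, hy⟩ : ∃ y : Sphere d, u = (‖u‖ : ℂ) • y.1 := by
    by_cases hu : u = 0
    · exact ⟨e, by simp [hu]⟩
    · have hn : (‖u‖ : ℂ) ≠ 0 := by simpa using hu
      refine ⟨⟨((‖u‖⁻¹ : ℝ) : ℂ) • u, by simp [norm_smul, hu]⟩, ?_⟩
      simp [smul_smul, hn]
  obtain ⟨U, hU⟩ := exists_unitary_map_eq e y
  rw [← integral_sphereMap U, ← integral_const_mul]
  congr 1
  funext x
  have h1 : inner ℂ u (sphereMap U x).1 = (‖u‖ : ℂ) * inner ℂ e.1 x.1 := by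
    conv_lhs => rw [hy, inner_smul_left, ← hU]
    rw [Complex.conj_ofReal]
    congr 1
    exact U.inner_map_map e.1 x.1
  rw [h1, norm_mul, mul_pow]
  simp

lemma exists_sphereIntegral_eq (hd : 1 ≤ d) (k : ℕ) :
    ∃ c : ℂ, ∀ f ∈ homPoly d k k,
      sphereIntegral d f = c * constTerm d ((laplacian d ^ k) f) := by
  obtain ⟨c, hc⟩ := exists_integral_norm_inner_pow hd k
  have hk : (k.factorial : ℂ) ≠ 0 := Nat.cast_ne_zero.2 k.factorial_ne_zero
  refine ⟨c / (k.factorial : ℂ) ^ 2, fun f hf => ?_⟩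
  have h := LinearMap.eqOn_span (f := sphereIntegral d)
    (g := (c / (k.factorial : ℂ) ^ 2) • (constTerm d ∘ₗ (laplacian d ^ k))) ?_
    (homPoly_le_span k hf)
  · simpa using h
  · rintro _ ⟨u, rfl⟩
    have h1 : sphereIntegral d (zForm (fun i => (starRingEnd ℂ) (u i)) ^ k * zbarForm u ^ k) =
        (‖(WithLp.toLp 2 u : EuclideanSpace ℂ (Fin d))‖ : ℂ) ^ (2 * k) * c := by
      rw [← hc]
      exact integral_congr_ae (Filter.Eventually.of_forall fun x => restrictSphere_forms_pow u k x)
    have h2 : ∑ i, (starRingEnd ℂ) (u i) * u i =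
        (‖(WithLp.toLp 2 u : EuclideanSpace ℂ (Fin d))‖ : ℂ) ^ 2 := by
      rw [← Complex.ofReal_pow, EuclideanSpace.norm_sq_eq, Complex.ofReal_sum]
      refine Finset.sum_congr rfl fun i _ => ?_
      rw [mul_comm, Complex.mul_conj, Complex.normSq_eq_norm_sq]
    rw [h1, LinearMap.smul_apply, LinearMap.comp_apply, laplacian_iterate_forms, h2, constTerm]
    simp only [AlgHom.toLinearMap_apply, bieval, MvPolynomial.aeval_C, smul_eq_mul,
      Algebra.algebraMap_self, RingHom.id_apply]
    rw [pow_mul]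
    field_simp

lemma one_mem_harmPoly : (1 : BiPoly d) ∈ harmPoly d 0 0 :=
  ⟨homPoly_one, laplacian_eq_zero_of_left homPoly_one⟩

/-- The mean over the sphere of a polynomial of bidegree `(k,k)` is a multiple of its `k`-fold
Laplacian. The factor is found from the polynomial `|z|^{2k}`, whose mean is `1`. -/
lemma sphereIntegral_eq (hd : 1 ≤ d) (k : ℕ) {f : BiPoly d} (hf : f ∈ homPoly d k k) :
    sphereIntegral d f =
      ((d - 1).factorial : ℂ) / ((k.factorial : ℂ) * ((k + d - 1).factorial : ℂ)) *
        constTerm d ((laplacian d ^ k) f) := by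
  obtain ⟨c, hc⟩ := exists_sphereIntegral_eq hd k
  rw [hc f hf]
  congr 1
  have h1 := hc (normSqPoly d ^ k * 1) (by simpa using normSqPoly_pow_mul_mem homPoly_one k)
  have h2 : sphereIntegral d (normSqPoly d ^ k * 1) = 1 := by
    have := isProbabilityMeasure_sphereMeasure hd
    change ∫ x, restrictSphere d (normSqPoly d ^ k * 1) x ∂(sphereMeasure d) = 1
    rw [restrictSphere_normSqPoly_pow_mul]
    simp [restrictSphere_apply]
  rw [h2, laplacian_iterate_normSqPoly_pow_mul k one_mem_harmPoly, map_smul] at h1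
  have h3 : constTerm d 1 = 1 := by simp [constTerm]
  have h4 : (∏ i ∈ Finset.range k, ((i + 1) * (d + 0 + 0 + i))) * (d - 1).factorial =
      k.factorial * (k + d - 1).factorial := by
    clear hf hc h1 h2 h3
    induction k with
    | zero => simp
    | succ k ih =>
      have : (k + 1 + d - 1).factorial = (d + k) * (k + d - 1).factorial := by
        rw [show k + 1 + d - 1 = (k + d - 1) + 1 by omega, Nat.factorial_succ]
        congr 1
        omega
      rw [Finset.prod_range_succ, this, Nat.factorial_succ]
      linear_combination (k + 1) * (d + k) * ih
  have h5 := congrArg (fun n : ℕ => (n : ℂ)) h4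
  simp only [Nat.cast_mul] at h5
  have hk : (k.factorial : ℂ) ≠ 0 := Nat.cast_ne_zero.2 k.factorial_ne_zero
  have hk' : ((k + d - 1).factorial : ℂ) ≠ 0 := Nat.cast_ne_zero.2 (Nat.factorial_ne_zero _)
  rw [h3, smul_eq_mul, mul_one] at h1
  rw [eq_div_iff (mul_ne_zero hk hk'), ← h5]
  linear_combination (-((d - 1).factorial : ℂ)) * h1

lemma sphereIntegral_mul_eq_zero (hd : 1 ≤ d) {p q r s : ℕ} (h : ¬(p = s ∧ q = r)) {f g : BiPoly d}
    (hf : f ∈ harmPoly d p q) (hg : g ∈ harmPoly d r s) : sphereIntegral d (f * g) = 0 := by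
  have hfg := homPoly_mul hf.1 hg.1
  by_cases hpq : p + r = q + s
  · rw [← hpq] at hfg
    rw [sphereIntegral_eq hd _ hfg, laplacian_iterate_mul_eq_zero _ hf hg (by omega), map_zero,
      mul_zero]
  · exact sphereIntegral_eq_zero hpq hfg

/-! ### Complex conjugation -/

/-- The polynomial of the complex conjugate function. -/
noncomputable def conjPoly (d : ℕ) : BiPoly d →+* BiPoly d :=
  (MvPolynomial.rename (R := ℂ) (Sum.swap : Fin d ⊕ Fin d → Fin d ⊕ Fin d)).toRingHom.comp
    (MvPolynomial.map (starRingEnd ℂ))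

lemma conjPoly_apply (f : BiPoly d) :
    conjPoly d f = MvPolynomial.rename Sum.swap (MvPolynomial.map (starRingEnd ℂ) f) := rfl

lemma swap_injective : Function.Injective (Sum.swap : Fin d ⊕ Fin d → Fin d ⊕ Fin d) :=
  Sum.swap_leftInverse.injective

lemma restrictSphere_conjPoly (f : BiPoly d) (x : Sphere d) :
    restrictSphere d (conjPoly d f) x = (starRingEnd ℂ) (restrictSphere d f x) := by
  have : ((bieval (fun i => x.1 i)
      (fun i => (starRingEnd ℂ) (x.1 i))).toRingHom.comp (conjPoly d)) =
      (starRingEnd ℂ).comp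
        (bieval (fun i => x.1 i) (fun i => (starRingEnd ℂ) (x.1 i))).toRingHom := by
    apply MvPolynomial.ringHom_ext
    · intro c
      simp [conjPoly_apply, bieval]
    · rintro (i | i) <;> simp [conjPoly_apply]
  exact congrArg (fun F => F f) this

lemma conjPoly_mem_homPoly {p q : ℕ} {f : BiPoly d} (hf : f ∈ homPoly d p q) :
    conjPoly d f ∈ homPoly d q p := by
  intro m hm
  have hm' : m = Finsupp.mapDomain Sum.swap (Finsupp.mapDomain Sum.swap m) := by
    rw [← Finsupp.mapDomain_comp]
    simp
  rw [hm', conjPoly_apply, MvPolynomial.coeff_rename_mapDomain _ swap_injective,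
    MvPolynomial.coeff_map] at hm
  have := hf (d := Finsupp.mapDomain Sum.swap m) (fun h => hm (by rw [h, map_zero]))
  rw [weight_biexp] at this ⊢
  have h1 : ∀ i, Finsupp.mapDomain Sum.swap m (Sum.inl i : Fin d ⊕ Fin d) = m (Sum.inr i) := by
    intro i
    exact Finsupp.mapDomain_apply swap_injective m (Sum.inr i)
  have h2 : ∀ i, Finsupp.mapDomain Sum.swap m (Sum.inr i : Fin d ⊕ Fin d) = m (Sum.inl i) := by
    intro i
    exact Finsupp.mapDomain_apply swap_injective m (Sum.inl i)
  simp only [h1, h2, Prod.mk.injEq] at this ⊢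
  exact this.symm

lemma pderiv_conjPoly (i : Fin d ⊕ Fin d) (f : BiPoly d) :
    MvPolynomial.pderiv i.swap (conjPoly d f) = conjPoly d (MvPolynomial.pderiv i f) := by
  rw [conjPoly_apply, conjPoly_apply, MvPolynomial.pderiv_rename swap_injective,
    MvPolynomial.pderiv_map]

lemma laplacian_conjPoly (f : BiPoly d) :
    laplacian d (conjPoly d f) = conjPoly d (laplacian d f) := by
  rw [laplacian_apply, laplacian_apply, map_sum]
  refine Finset.sum_congr rfl fun i _ => ?_
  rw [← pderiv_conjPoly, ← pderiv_conjPoly, pderiv_comm]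
  rfl

lemma conjPoly_mem_harmPoly {p q : ℕ} {f : BiPoly d} (hf : f ∈ harmPoly d p q) :
    conjPoly d f ∈ harmPoly d q p :=
  mem_harmPoly.2 ⟨conjPoly_mem_homPoly hf.1, by
    rw [laplacian_conjPoly, harmPoly.laplacian_eq hf, map_zero]⟩

lemma conj_mem_Hom {p q : ℕ} {f : Sphere d → ℂ} (hf : f ∈ Hom d p q) :
    (fun x => (starRingEnd ℂ) (f x)) ∈ Hom d q p := by
  obtain ⟨g, hg, rfl⟩ := hf
  exact ⟨_, conjPoly_mem_homPoly hg, funext (restrictSphere_conjPoly g)⟩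

lemma mul_mem_Hom {p q r s : ℕ} {f g : Sphere d → ℂ} (hf : f ∈ Hom d p q) (hg : g ∈ Hom d r s) :
    f * g ∈ Hom d (p + r) (q + s) := by
  obtain ⟨F, hF, rfl⟩ := hf
  obtain ⟨G, hG, rfl⟩ := hg
  exact ⟨F * G, homPoly_mul hF hG, restrictSphere_mul F G⟩

/-! ### The spaces `H(p,q)` in `L²` of the sphere -/

lemma Harm_le_Hom (p q : ℕ) : Harm d p q ≤ Hom d p q := Submodule.map_mono inf_le_left

lemma continuous_of_mem_Hom {p q : ℕ} {f : Sphere d → ℂ} (hf : f ∈ Hom d p q) : Continuous f := by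
  obtain ⟨g, _, rfl⟩ := hf
  exact continuous_restrictSphere g

lemma continuous_of_mem_Harm {p q : ℕ} {f : Sphere d → ℂ} (hf : f ∈ Harm d p q) : Continuous f :=
  continuous_of_mem_Hom (Harm_le_Hom p q hf)

lemma integral_mul_conj_restrictSphere (f g : BiPoly d) :
    ∫ x, restrictSphere d f x * (starRingEnd ℂ) (restrictSphere d g x) ∂(sphereMeasure d) =
      sphereIntegral d (f * conjPoly d g) := by
  change _ = ∫ x, restrictSphere d (f * conjPoly d g) x ∂(sphereMeasure d)
  congr 1
  funext x
  rw [restrictSphere_mul, Pi.mul_apply, restrictSphere_conjPoly]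

lemma integral_mul_conj_eq_zero (hd : 1 ≤ d) {i j : ℕ × ℕ} (hij : i ≠ j) {f g : Sphere d → ℂ}
    (hf : f ∈ Harm d i.1 i.2) (hg : g ∈ Harm d j.1 j.2) :
    ∫ x, f x * (starRingEnd ℂ) (g x) ∂(sphereMeasure d) = 0 := by
  obtain ⟨F, hF, rfl⟩ := hf
  obtain ⟨G, hG, rfl⟩ := hg
  rw [integral_mul_conj_restrictSphere]
  exact sphereIntegral_mul_eq_zero hd (fun h => hij (Prod.ext h.1 h.2)) hF
    (conjPoly_mem_harmPoly hG)

lemma integral_mul_conj_self (f : Sphere d → ℂ) :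
    ∫ x, f x * (starRingEnd ℂ) (f x) ∂(sphereMeasure d) =
      ((∫ x, ‖f x‖ ^ 2 ∂(sphereMeasure d) : ℝ) : ℂ) := by
  rw [← integral_complex_ofReal]
  congr 1
  funext x
  rw [Complex.mul_conj, Complex.normSq_eq_norm_sq]

lemma eq_zero_of_integral_mul_conj_self {f : Sphere d → ℂ} (hf : Continuous f)
    (h : ∫ x, f x * (starRingEnd ℂ) (f x) ∂(sphereMeasure d) = 0) : f = 0 := by
  have := isOpenPosMeasure_sphereMeasure (d := d)
  rw [integral_mul_conj_self, Complex.ofReal_eq_zero, integral_eq_zero_iff_of_nonneg] at h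
  · have h1 : Continuous fun x => ‖f x‖ ^ 2 := by fun_prop
    have h2 := (Continuous.ae_eq_iff_eq (sphereMeasure d) h1 continuous_zero).1 h
    funext x
    simpa using congrFun h2 x
  · intro x
    positivity
  · have h1 : Continuous fun x => f x * (starRingEnd ℂ) (f x) := by fun_prop
    have h2 := (integrable_of_continuous h1).norm
    simpa [sq] using h2

/-- The inner product of `L²` on a space of continuous functions on the sphere. -/
@[reducible]
noncomputable def sphereInnerCore (V : Submodule ℂ (Sphere d → ℂ)) (hV : ∀ f ∈ V, Continuous f) :
    InnerProductSpace.Core ℂ V where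
  inner f g := ∫ x, g.1 x * (starRingEnd ℂ) (f.1 x) ∂(sphereMeasure d)
  conj_inner_symm f g := by
    rw [← integral_conj]
    congr 1
    funext x
    simp [mul_comm]
  re_inner_nonneg f := by
    rw [integral_mul_conj_self]
    simp only [RCLike.re_to_complex, Complex.ofReal_re]
    exact integral_nonneg fun x => by positivity
  add_left f g h := by
    rw [← integral_add]
    · congr 1
      funext x
      simp [mul_add]
    all_goals
      have h1 := hV f f.2
      have h2 := hV g g.2
      have h3 := hV h h.2
      exact integrable_of_continuous (by fun_prop)
  smul_left f g c := by
    rw [← integral_const_mul]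
    congr 1
    funext x
    simp
    ring
  definite f h := Subtype.ext (eq_zero_of_integral_mul_conj_self (hV f f.2) h)

/-- Finite-dimensional spaces of continuous functions on the sphere have orthonormal bases. -/
lemma exists_orthonormal (V : Submodule ℂ (Sphere d → ℂ)) [FiniteDimensional ℂ V]
    (hV : ∀ f ∈ V, Continuous f) :
    ∃ e : Fin (Module.finrank ℂ V) → Sphere d → ℂ, (∀ i, e i ∈ V) ∧
      (∀ i, ∫ x, e i x * (starRingEnd ℂ) (e i x) ∂(sphereMeasure d) = 1) ∧
      ∀ f ∈ V, ∀ x, f x =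
        ∑ i, (∫ y, f y * (starRingEnd ℂ) (e i y) ∂(sphereMeasure d)) * e i x := by
  let core := sphereInnerCore V hV
  let _ : NormedAddCommGroup V := core.toNormedAddCommGroup
  let _ : InnerProductSpace ℂ V := InnerProductSpace.ofCore core.toCore
  let b := stdOrthonormalBasis ℂ V
  refine ⟨fun i => (b i).1, fun i => (b i).2, fun i => ?_, fun f hf x => ?_⟩
  · have := b.inner_eq_one i
    exact this
  · have h := congrArg (fun g : V => g.1 x) (b.sum_repr' ⟨f, hf⟩)
    simp only [AddSubmonoidClass.coe_finsetSum, Finset.sum_apply] at h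
    exact h.symm

/-! ### Sums of the spaces `H(p,q)` -/

lemma Harm_le_polySpace {τ : Finset (ℕ × ℕ)} {i : ℕ × ℕ} (hi : i ∈ τ) :
    Harm d i.1 i.2 ≤ polySpace d τ :=
  le_iSup₂_of_le i hi le_rfl

lemma polySpace_insert (i : ℕ × ℕ) (τ : Finset (ℕ × ℕ)) :
    polySpace d (insert i τ) = Harm d i.1 i.2 ⊔ polySpace d τ :=
  Finset.iSup_insert i τ _

lemma continuous_and_orthogonal_of_mem_polySpace (hd : 1 ≤ d) {τ : Finset (ℕ × ℕ)} {i : ℕ × ℕ}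
    (hi : i ∉ τ) {f g : Sphere d → ℂ} (hf : f ∈ Harm d i.1 i.2) (hg : g ∈ polySpace d τ) :
    Continuous g ∧ ∫ x, g x * (starRingEnd ℂ) (f x) ∂(sphereMeasure d) = 0 := by
  have hfc := continuous_of_mem_Harm hf
  let W : Submodule ℂ (Sphere d → ℂ) :=
    { carrier := {g | Continuous g ∧ ∫ x, g x * (starRingEnd ℂ) (f x) ∂(sphereMeasure d) = 0}
      zero_mem' := ⟨continuous_zero, by simp⟩
      add_mem' := by
        rintro a b ⟨ha, ha'⟩ ⟨hb, hb'⟩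
        refine ⟨ha.add hb, ?_⟩
        simp only [Pi.add_apply, add_mul]
        rw [integral_add (integrable_of_continuous (by fun_prop))
          (integrable_of_continuous (by fun_prop)), ha', hb', add_zero]
      smul_mem' := by
        rintro c a ⟨ha, ha'⟩
        refine ⟨ha.const_smul c, ?_⟩
        simp only [Pi.smul_apply, smul_eq_mul, mul_assoc]
        rw [integral_const_mul, ha', mul_zero] }
  have hW : polySpace d τ ≤ W := by
    refine iSup₂_le fun j hj a ha => ⟨continuous_of_mem_Harm ha, ?_⟩
    exact integral_mul_conj_eq_zero hd (fun h : j = i => hi (h ▸ hj)) ha hf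
  exact hW hg

lemma polySpace_empty : polySpace d ∅ = ⊥ :=
  le_bot_iff.1 (iSup₂_le fun i hi => absurd hi (Finset.notMem_empty i))

instance (τ : Finset (ℕ × ℕ)) : FiniteDimensional ℂ (polySpace d τ) := by
  classical
  induction τ using Finset.induction_on with
  | empty => rw [polySpace_empty]; infer_instance
  | insert i τ _ ih => rw [polySpace_insert]; infer_instance

/-- The spaces `H(p,q)` are orthogonal, so that the dimensions add up. -/
lemma finrank_polySpace (hd : 1 ≤ d) (τ : Finset (ℕ × ℕ)) :
    Module.finrank ℂ (polySpace d τ) = ∑ i ∈ τ, Module.finrank ℂ (Harm d i.1 i.2) := by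
  classical
  induction τ using Finset.induction_on with
  | empty => rw [polySpace_empty, finrank_bot, Finset.sum_empty]
  | insert i τ hi ih =>
    have hdisj : Harm d i.1 i.2 ⊓ polySpace d τ = ⊥ := by
      rw [eq_bot_iff]
      rintro f ⟨hf1, hf2⟩
      obtain ⟨hc, h0⟩ := continuous_and_orthogonal_of_mem_polySpace hd hi hf1 hf2
      exact eq_zero_of_integral_mul_conj_self hc h0
    have h := Submodule.finrank_sup_add_finrank_inf_eq (Harm d i.1 i.2) (polySpace d τ)
    rw [hdisj, finrank_bot, add_zero] at h
    rw [Finset.sum_insert hi, ← ih, ← h, polySpace_insert]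

lemma restrictSphere_mem_polySpace (hd : 1 ≤ d) {m n k : ℕ} (hm : k ≤ m) (hn : k ≤ n)
    {f : BiPoly d} (hf : f ∈ homPoly d m n) (hk : (laplacian d ^ (k + 1)) f = 0) :
    restrictSphere d f ∈
      polySpace d ((Finset.range (k + 1)).image fun j => (m - j, n - j)) := by
  obtain ⟨h, hh, hsum⟩ := exists_harmonic_decomposition hd (k + 1) (by omega) (by omega) hf hk
  rw [hsum, map_sum]
  refine Submodule.sum_mem _ fun j hj => ?_
  rw [restrictSphere_normSqPoly_pow_mul]
  have h1 : restrictSphere d (h j) ∈ Harm d (m - j) (n - j) :=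
    Submodule.mem_map_of_mem (hh j (Finset.mem_range.1 hj))
  have h2 : (m - j, n - j) ∈ (Finset.range (k + 1)).image fun j => (m - j, n - j) :=
    Finset.mem_image_of_mem (fun j => (m - j, n - j)) hj
  exact Harm_le_polySpace h2 h1

lemma mul_mem_polySpace (hd : 1 ≤ d) {a b : ℕ × ℕ} {f g : Sphere d → ℂ}
    (hf : f ∈ Harm d a.1 a.2) (hg : g ∈ Harm d b.1 b.2) :
    f * g ∈ polySpace d (indexMul a b) := by
  obtain ⟨F, hF, rfl⟩ := hf
  obtain ⟨G, hG, rfl⟩ := hg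
  rw [← restrictSphere_mul]
  exact restrictSphere_mem_polySpace hd (by omega) (by omega) (homPoly_mul hF.1 hG.1)
    (laplacian_iterate_mul_eq_zero _ hF hG (Nat.lt_succ_self _))

/-! ### Zonal harmonics -/

/-- The coefficient of `z^(p-j) conj(z)^(q-j)` in `Q_{pq}`. The value `1` for `p = q = 0` is put in
separately, as for `d = 1` the general formula has the factor `p + q + d - 1 = 0` there. -/
noncomputable def gegCoeff (d p q j : ℕ) : ℝ :=
  if p = 0 ∧ q = 0 then 1
  else ((p + q + d - 1 : ℕ) : ℝ) / ((d - 1).factorial : ℝ) *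
    ((-1) ^ j * ((d + p + q - j - 2).factorial : ℝ) /
        ((j.factorial : ℝ) * ((p - j).factorial : ℝ) * ((q - j).factorial : ℝ)))

lemma gegenbauer_eq (d p q : ℕ) (z : ℂ) : gegenbauer d p q z =
    ∑ j ∈ Finset.range (min p q + 1),
      (gegCoeff d p q j : ℂ) * (z ^ (p - j) * (starRingEnd ℂ) z ^ (q - j)) := by
  unfold gegenbauer gegCoeff
  split_ifs with h
  · simp [h.1, h.2]
  · rw [Finset.mul_sum]
    refine Finset.sum_congr rfl fun j _ => ?_
    push_cast
    ring

lemma gegCoeff_zero (hd : 1 ≤ d) (p q : ℕ) : gegCoeff d p q 0 =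
    ((p + q + d - 1).factorial : ℝ) /
      (((d - 1).factorial : ℝ) * (p.factorial : ℝ) * (q.factorial : ℝ)) := by
  unfold gegCoeff
  split_ifs with h
  · have : ((d - 1).factorial : ℝ) ≠ 0 := Nat.cast_ne_zero.2 (Nat.factorial_ne_zero _)
    simp [h.1, h.2, this]
  · rw [show p + q + d - 1 = (d + p + q - 0 - 2) + 1 by omega, Nat.factorial_succ]
    push_cast
    field_simp
    simp

lemma gegCoeff_zero_pos (hd : 1 ≤ d) (p q : ℕ) : 0 < gegCoeff d p q 0 := by
  rw [gegCoeff_zero hd]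
  have := Nat.factorial_pos
  positivity

/-- The recurrence for the coefficients of `Q_{pq}` which expresses that `Q_{pq}(⟨·,y⟩)` is
harmonic. -/
lemma gegCoeff_succ (hd : 1 ≤ d) {p q j : ℕ} (hj : j < min p q) :
    gegCoeff d p q (j + 1) * ((j + 1) * (d + (p - (j + 1)) + (q - (j + 1)) + j) : ℕ) =
      - (gegCoeff d p q j * ((p - j) * (q - j) : ℕ)) := by
  obtain ⟨a, rfl⟩ : ∃ a, p = j + 1 + a := Nat.exists_eq_add_of_le (by omega)
  obtain ⟨b, rfl⟩ : ∃ b, q = j + 1 + b := Nat.exists_eq_add_of_le (by omega)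
  obtain ⟨e, rfl⟩ : ∃ e, d = e + 1 := ⟨d - 1, by omega⟩
  have h1 : e + 1 + (j + 1 + a) + (j + 1 + b) - (j + 1) - 2 = e + a + j + b := by omega
  have h2 : e + 1 + (j + 1 + a) + (j + 1 + b) - j - 2 = e + a + j + b + 1 := by omega
  have h3 : j + 1 + a - (j + 1) = a := by omega
  have h4 : j + 1 + b - (j + 1) = b := by omega
  have h5 : j + 1 + a - j = a + 1 := by omega
  have h6 : j + 1 + b - j = b + 1 := by omega
  have h7 : ¬(j + 1 + a = 0 ∧ j + 1 + b = 0) := by omega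
  unfold gegCoeff
  rw [if_neg h7, if_neg h7, h1, h2, h3, h4, h5, h6]
  simp only [Nat.factorial_succ, pow_succ]
  have h8 := fun n => Nat.cast_ne_zero (R := ℝ).2 (Nat.factorial_ne_zero n)
  have hj : (j : ℝ) + 1 ≠ 0 := by positivity
  have ha : (a : ℝ) + 1 ≠ 0 := by positivity
  have hb : (b : ℝ) + 1 ≠ 0 := by positivity
  push_cast
  have := h8 j
  have := h8 a
  have := h8 b
  field_simp
  ring

/-- The coordinates of a point of the sphere. -/
abbrev coords (y : Sphere d) : Fin d → ℂ := fun i => y.1 i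

/-- The coordinates of the complex conjugate of a point of the sphere. -/
abbrev conjCoords (y : Sphere d) : Fin d → ℂ := fun i => (starRingEnd ℂ) (y.1 i)

lemma ip_eq_sum (x y : Sphere d) : ip x y = ∑ i, conjCoords y i * x.1 i := inner_eq_sum y.1 x.1

lemma ip_self (x : Sphere d) : ip x x = 1 := by
  rw [ip, inner_self_eq_norm_sq_to_K]
  simp

lemma sum_conjCoords_mul_coords (y : Sphere d) : ∑ i, conjCoords y i * coords y i = 1 := by
  rw [← ip_self y, ip_eq_sum]

/-- The polynomial `⟨z,y⟩^a conj(⟨z,y⟩)^b`. -/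
noncomputable def ipPow (y : Sphere d) (a b : ℕ) : BiPoly d :=
  zForm (conjCoords y) ^ a * zbarForm (coords y) ^ b

lemma ipPow_mem (y : Sphere d) (a b : ℕ) : ipPow y a b ∈ homPoly d a b := forms_pow_mem _ _ a b

lemma restrictSphere_ipPow (x y : Sphere d) (a b : ℕ) :
    restrictSphere d (ipPow y a b) x = ip x y ^ a * (starRingEnd ℂ) (ip x y) ^ b := by
  rw [restrictSphere_apply, ipPow, map_mul, map_pow, map_pow, bieval_zForm, bieval_zbarForm,
    ip_eq_sum]
  simp

/-- The homogeneous polynomial which restricts to `Q_{pq}(⟨·,y⟩)`. -/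
noncomputable def zonalPoly (p q : ℕ) (y : Sphere d) : BiPoly d :=
  ∑ j ∈ Finset.range (min p q + 1),
    (gegCoeff d p q j : ℂ) • (normSqPoly d ^ j * ipPow y (p - j) (q - j))

lemma restrictSphere_zonalPoly (p q : ℕ) (x y : Sphere d) :
    restrictSphere d (zonalPoly p q y) x = gegenbauer d p q (ip x y) := by
  rw [gegenbauer_eq, zonalPoly, map_sum, Finset.sum_apply]
  refine Finset.sum_congr rfl fun j _ => ?_
  rw [map_smul, restrictSphere_normSqPoly_pow_mul, Pi.smul_apply, restrictSphere_ipPow, smul_eq_mul]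

lemma laplacian_ipPow (y : Sphere d) (a b : ℕ) :
    laplacian d (ipPow y a b) = ((a * b : ℕ) : ℂ) • ipPow y (a - 1) (b - 1) := by
  rw [ipPow, laplacian_forms, sum_conjCoords_mul_coords, MvPolynomial.smul_eq_C_mul, ipPow]
  push_cast
  ring_nf

lemma zonalPoly_mem_harmPoly (hd : 1 ≤ d) (p q : ℕ) (y : Sphere d) :
    zonalPoly p q y ∈ harmPoly d p q := by
  refine mem_harmPoly.2 ⟨Submodule.sum_mem _ fun j hj => Submodule.smul_mem _ _ ?_, ?_⟩
  · have hj' := Finset.mem_range.1 hj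
    have := normSqPoly_pow_mul_mem (ipPow_mem y (p - j) (q - j)) j
    rwa [show p - j + j = p by omega, show q - j + j = q by omega] at this
  · set A : ℕ → BiPoly d := fun j => (gegCoeff d p q j : ℂ) •
      ((((p - j) * (q - j) : ℕ) : ℂ) • (normSqPoly d ^ j * ipPow y (p - j - 1) (q - j - 1))) with hA
    have h0 : laplacian d ((gegCoeff d p q 0 : ℂ) • (normSqPoly d ^ 0 * ipPow y (p - 0) (q - 0))) =
        A 0 := by
      simp only [hA, map_smul, pow_zero, one_mul, laplacian_ipPow]
    have hstep : ∀ j < min p q, laplacian d ((gegCoeff d p q (j + 1) : ℂ) •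
        (normSqPoly d ^ (j + 1) * ipPow y (p - (j + 1)) (q - (j + 1)))) = A (j + 1) - A j := by
      intro j hj
      rw [map_smul, laplacian_normSqPoly_pow_mul j (ipPow_mem y _ _), laplacian_ipPow, smul_add,
        add_comm, sub_eq_add_neg]
      congr 1
      · simp only [hA, mul_smul_comm]
      · have h := congrArg (fun r : ℝ => (r : ℂ)) (gegCoeff_succ hd hj)
        simp only [Complex.ofReal_mul, Complex.ofReal_neg, Complex.ofReal_natCast] at h
        simp only [hA, smul_smul, Nat.sub_sub]
        rw [← neg_smul, ← h, mul_smul, Nat.cast_smul_eq_nsmul ℂ, nsmul_eq_mul]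
    have hlast : A (min p q) = 0 := by
      have : (p - min p q) * (q - min p q) = 0 := by
        rw [Nat.mul_eq_zero]
        omega
      simp only [hA, this, Nat.cast_zero, zero_smul, smul_zero]
    have hsum : ∀ m ≤ min p q, ∑ j ∈ Finset.range (m + 1), laplacian d ((gegCoeff d p q j : ℂ) •
        (normSqPoly d ^ j * ipPow y (p - j) (q - j))) = A m := by
      intro m hm
      induction m with
      | zero => rw [Finset.sum_range_one, h0]
      | succ m ih => rw [Finset.sum_range_succ, ih (by omega), hstep m (by omega)]; abel
    rw [zonalPoly, map_sum, hsum _ le_rfl, hlast]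

lemma zonal_mem_Harm (hd : 1 ≤ d) (p q : ℕ) (y : Sphere d) :
    (fun x => gegenbauer d p q (ip x y)) ∈ Harm d p q :=
  ⟨_, zonalPoly_mem_harmPoly hd p q y, funext fun x => restrictSphere_zonalPoly p q x y⟩

/-! ### The reproducing property -/

lemma laplacian_ipPow_mul (y : Sphere d) (a b : ℕ) {p q : ℕ} {f : BiPoly d}
    (hf : f ∈ harmPoly d p q) : laplacian d (ipPow y a b * f) =
      ((a * b : ℕ) : ℂ) • (ipPow y (a - 1) (b - 1) * f) +
      (a : ℂ) • (ipPow y (a - 1) b *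
        ∑ i, conjCoords y i • MvPolynomial.pderiv (Sum.inr i) f) +
      (b : ℂ) • (ipPow y a (b - 1) * ∑ i, coords y i • MvPolynomial.pderiv (Sum.inl i) f) := by
  rw [laplacian_mul, harmPoly.laplacian_eq hf, mul_zero, add_zero, laplacian_ipPow, smul_mul_assoc,
    add_assoc, Finset.sum_add_distrib]
  congr 2
  · rw [Finset.mul_sum, Finset.smul_sum]
    refine Finset.sum_congr rfl fun i _ => ?_
    rw [ipPow, pderiv_inl_forms, ipPow, map_mul, MvPolynomial.smul_eq_C_mul,
      MvPolynomial.smul_eq_C_mul]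
    ring
  · rw [Finset.mul_sum, Finset.smul_sum]
    refine Finset.sum_congr rfl fun i _ => ?_
    rw [ipPow, pderiv_inr_forms, ipPow, map_mul, MvPolynomial.smul_eq_C_mul,
      MvPolynomial.smul_eq_C_mul]
    ring

lemma sum_smul_pderiv_inr_mem {p q : ℕ} {f : BiPoly d} (hf : f ∈ harmPoly d p (q + 1))
    (c : Fin d → ℂ) : ∑ i, c i • MvPolynomial.pderiv (Sum.inr i) f ∈ harmPoly d p q :=
  Submodule.sum_mem _ fun i _ => Submodule.smul_mem _ _ (harmPoly_pderiv_inr hf i)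

lemma sum_smul_pderiv_inl_mem {p q : ℕ} {f : BiPoly d} (hf : f ∈ harmPoly d (p + 1) q)
    (c : Fin d → ℂ) : ∑ i, c i • MvPolynomial.pderiv (Sum.inl i) f ∈ harmPoly d p q :=
  Submodule.sum_mem _ fun i _ => Submodule.smul_mem _ _ (harmPoly_pderiv_inl hf i)

/-- A harmonic polynomial is orthogonal to the zonal monomials which are too short to be paired
with all of its variables. -/
lemma laplacian_iterate_ipPow_mul_eq_zero (y : Sphere d) (k : ℕ) {a b m n : ℕ} (ha : a + m = k)
    (hb : b + n = k) (han : a < n) {f : BiPoly d} (hf : f ∈ harmPoly d m n) :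
    (laplacian d ^ k) (ipPow y a b * f) = 0 := by
  induction k generalizing a b m n f with
  | zero => omega
  | succ k ih =>
    rw [pow_succ, Module.End.mul_apply, laplacian_ipPow_mul y a b hf]
    simp only [map_add, map_smul]
    have h1 : ((a * b : ℕ) : ℂ) • (laplacian d ^ k) (ipPow y (a - 1) (b - 1) * f) = 0 := by
      rcases a with _ | a
      · simp
      rcases b with _ | b
      · simp
      rw [ih (by omega) (by omega) (by omega) hf, smul_zero]
    have h2 : (a : ℂ) • (laplacian d ^ k) (ipPow y (a - 1) b *
        ∑ i, conjCoords y i • MvPolynomial.pderiv (Sum.inr i) f) = 0 := by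
      rcases a with _ | a
      · simp
      obtain ⟨n, rfl⟩ : ∃ n', n = n' + 1 := ⟨n - 1, by omega⟩
      rw [ih (by omega) (by omega) (by omega) (sum_smul_pderiv_inr_mem hf _), smul_zero]
    have h3 : (b : ℂ) • (laplacian d ^ k) (ipPow y a (b - 1) *
        ∑ i, coords y i • MvPolynomial.pderiv (Sum.inl i) f) = 0 := by
      rcases b with _ | b
      · simp
      obtain ⟨m, rfl⟩ : ∃ m', m = m' + 1 := ⟨m - 1, by omega⟩
      rw [ih (by omega) (by omega) (by omega) (sum_smul_pderiv_inl_mem hf _), smul_zero]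
    rw [h1, h2, h3, add_zero, add_zero]

/-- Pairing a harmonic polynomial with the zonal monomial of the matching bidegree
evaluates it at `y`. -/
lemma constTerm_laplacian_iterate_ipPow_mul (y : Sphere d) (k : ℕ) {m n : ℕ} (hk : m + n = k)
    {f : BiPoly d} (hf : f ∈ harmPoly d m n) :
    constTerm d ((laplacian d ^ k) (ipPow y n m * f)) =
      ((k.factorial * m.factorial * n.factorial : ℕ) : ℂ) * restrictSphere d f y := by
  induction k generalizing m n f with
  | zero =>
    obtain ⟨rfl, rfl⟩ : m = 0 ∧ n = 0 := by omega
    have h := bieval_mul_mul_of_mem_homPoly hf.1 (coords y) (conjCoords y) 0 0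
    simp only [zero_mul, pow_zero, one_mul] at h
    simp only [pow_zero, Module.End.one_apply, ipPow, one_mul, Nat.factorial_zero, mul_one,
      Nat.cast_one, restrictSphere_apply]
    exact h
  | succ k ih =>
    rw [pow_succ, Module.End.mul_apply, laplacian_ipPow_mul y n m hf]
    simp only [map_add, map_smul]
    have h1 : ((n * m : ℕ) : ℂ) • (laplacian d ^ k) (ipPow y (n - 1) (m - 1) * f) = 0 := by
      rcases n with _ | n
      · simp
      rcases m with _ | m
      · simp
      rw [laplacian_iterate_ipPow_mul_eq_zero y k (by omega) (by omega) (by omega) hf, smul_zero]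
    have h2 : (n : ℂ) • constTerm d ((laplacian d ^ k) (ipPow y (n - 1) m *
        ∑ i, conjCoords y i • MvPolynomial.pderiv (Sum.inr i) f)) =
        n * ((k.factorial * m.factorial * n.factorial : ℕ) : ℂ) * restrictSphere d f y := by
      rcases n with _ | n
      · simp
      have he := congrArg (fun g => restrictSphere d g y) (euler_inr hf.1)
      simp only [restrictSphere_apply, map_sum, map_mul, bieval_X_inr, map_natCast] at he
      rw [Nat.add_sub_cancel, ih (by omega) (sum_smul_pderiv_inr_mem hf _)]
      simp only [restrictSphere_apply, map_sum, map_smul, smul_eq_mul]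
      rw [he, Nat.factorial_succ n]
      push_cast
      ring
    have h3 : (m : ℂ) • constTerm d ((laplacian d ^ k) (ipPow y n (m - 1) *
        ∑ i, coords y i • MvPolynomial.pderiv (Sum.inl i) f)) =
        m * ((k.factorial * m.factorial * n.factorial : ℕ) : ℂ) * restrictSphere d f y := by
      rcases m with _ | m
      · simp
      have he := congrArg (fun g => restrictSphere d g y) (euler_inl hf.1)
      simp only [restrictSphere_apply, map_sum, map_mul, bieval_X_inl, map_natCast] at he
      rw [Nat.add_sub_cancel, ih (by omega) (sum_smul_pderiv_inl_mem hf _)]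
      simp only [restrictSphere_apply, map_sum, map_smul, smul_eq_mul]
      rw [he, Nat.factorial_succ m]
      push_cast
      ring
    rw [← map_smul (constTerm d) ((n * m : ℕ) : ℂ), h1, h2, h3, map_zero, Nat.factorial_succ,
      ← hk]
    push_cast
    ring

/-- `Q_{pq}(⟨x,y⟩)` is the reproducing kernel of `H(p,q)`. -/
lemma integral_mul_conj_zonal (hd : 1 ≤ d) {p q : ℕ} {f : Sphere d → ℂ} (hf : f ∈ Harm d p q)
    (y : Sphere d) :
    ∫ x, f x * (starRingEnd ℂ) (gegenbauer d p q (ip x y)) ∂(sphereMeasure d) = f y := by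
  obtain ⟨F, hF, rfl⟩ := hf
  have h1 : ∀ x, restrictSphere d F x * (starRingEnd ℂ) (gegenbauer d p q (ip x y)) =
      restrictSphere d (∑ j ∈ Finset.range (min p q + 1),
        (gegCoeff d p q j : ℂ) • (ipPow y (q - j) (p - j) * F)) x := by
    intro x
    rw [gegenbauer_eq, map_sum, Finset.mul_sum, map_sum, Finset.sum_apply]
    refine Finset.sum_congr rfl fun j _ => ?_
    rw [map_smul, Pi.smul_apply, restrictSphere_mul, Pi.mul_apply, restrictSphere_ipPow]
    simp
    ring
  simp only [h1]
  change sphereIntegral d _ = _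
  rw [map_sum, Finset.sum_eq_single_of_mem 0 (by simp)]
  · have hmem : ipPow y (q - 0) (p - 0) * F ∈ homPoly d (p + q) (p + q) := by
      have := homPoly_mul (ipPow_mem y q p) hF.1
      rwa [add_comm q p] at this
    rw [map_smul, sphereIntegral_eq hd _ hmem, Nat.sub_zero, Nat.sub_zero,
      constTerm_laplacian_iterate_ipPow_mul y _ rfl hF, gegCoeff_zero hd]
    have h : ∀ n : ℕ, (n.factorial : ℂ) ≠ 0 := fun n => Nat.cast_ne_zero.2 n.factorial_ne_zero
    have := h (p + q)
    have := h (p + q + d - 1)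
    have := h (d - 1)
    have := h p
    have := h q
    rw [smul_eq_mul]
    push_cast
    field_simp
  · intro j hj hj0
    have hj' := Finset.mem_range.1 hj
    have hmem : ipPow y (q - j) (p - j) * F ∈ homPoly d (p + q - j) (p + q - j) := by
      have := homPoly_mul (ipPow_mem y (q - j) (p - j)) hF.1
      rwa [show q - j + p = p + q - j by omega, show p - j + q = p + q - j by omega] at this
    rw [map_smul, sphereIntegral_eq hd _ hmem,
      laplacian_iterate_ipPow_mul_eq_zero y _ (by omega) (by omega) (by omega) hF, map_zero,
      mul_zero, smul_zero]

/-! ### The addition formula -/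

/-- An orthonormal basis of `H(p,q)`, with the addition formula
`Q_{pq}(⟨x,y⟩) = ∑ e_i(x) conj(e_i(y))`. -/
lemma exists_addition_formula (hd : 1 ≤ d) (p q : ℕ) :
    ∃ e : Fin (Module.finrank ℂ (Harm d p q)) → Sphere d → ℂ, (∀ i, e i ∈ Harm d p q) ∧
      (∀ i, ∫ x, e i x * (starRingEnd ℂ) (e i x) ∂(sphereMeasure d) = 1) ∧
      (∀ f ∈ Harm d p q, ∀ x, f x =
        ∑ i, (∫ y, f y * (starRingEnd ℂ) (e i y) ∂(sphereMeasure d)) * e i x) ∧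
      ∀ x y, gegenbauer d p q (ip x y) = ∑ i, e i x * (starRingEnd ℂ) (e i y) := by
  obtain ⟨e, he, h1, hexp⟩ := exists_orthonormal (Harm d p q) fun f hf => continuous_of_mem_Harm hf
  refine ⟨e, he, h1, hexp, fun x y => ?_⟩
  rw [hexp _ (zonal_mem_Harm hd p q y) x]
  refine Finset.sum_congr rfl fun i _ => ?_
  rw [mul_comm, ← integral_mul_conj_zonal hd (he i) y, ← integral_conj]
  simp only [map_mul, Complex.conj_conj, mul_comm]

/-- The trace of the reproducing kernel is the dimension. -/
lemma gegenbauer_one (hd : 1 ≤ d) (p q : ℕ) :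
    gegenbauer d p q 1 = Module.finrank ℂ (Harm d p q) := by
  obtain ⟨e, he, h1, _, hadd⟩ := exists_addition_formula hd p q
  have := isProbabilityMeasure_sphereMeasure hd
  have h2 : ∫ x : Sphere d, gegenbauer d p q (ip x x) ∂(sphereMeasure d) = gegenbauer d p q 1 := by
    simp [ip_self]
  rw [← h2]
  simp only [hadd]
  rw [integral_finsetSum]
  · simp [h1]
  · intro i _
    have := continuous_of_mem_Harm (he i)
    exact integrable_of_continuous (by fun_prop)

lemma gegenbauer_eq_zero_of_finrank (hd : 1 ≤ d) {p q : ℕ}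
    (h : Module.finrank ℂ (Harm d p q) = 0) (x y : Sphere d) : gegenbauer d p q (ip x y) = 0 := by
  obtain ⟨e, _, _, _, hadd⟩ := exists_addition_formula hd p q
  rw [hadd]
  refine Finset.sum_eq_zero fun i _ => ?_
  exact absurd i.2 (by omega)

lemma gegenbauer_conj (d p q : ℕ) (z : ℂ) :
    (starRingEnd ℂ) (gegenbauer d p q z) = gegenbauer d q p z := by
  rw [gegenbauer_eq, gegenbauer_eq, map_sum, min_comm]
  refine Finset.sum_congr rfl fun j _ => ?_
  have : gegCoeff d p q j = gegCoeff d q p j := by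
    unfold gegCoeff
    rw [show p + q + d - 1 = q + p + d - 1 by omega,
      show d + p + q - j - 2 = d + q + p - j - 2 by omega]
    simp only [and_comm, mul_right_comm]
  rw [this]
  simp only [map_mul, map_pow, Complex.conj_ofReal, Complex.conj_conj]
  ring

lemma continuous_zonal (hd : 1 ≤ d) (p q : ℕ) (y : Sphere d) :
    Continuous fun x => gegenbauer d p q (ip x y) :=
  continuous_of_mem_Harm (zonal_mem_Harm hd p q y)

lemma integral_zonal_mul_conj_zonal (hd : 1 ≤ d) (i k : ℕ × ℕ) (y : Sphere d) :
    ∫ x, gegenbauer d i.1 i.2 (ip x y) * (starRingEnd ℂ) (gegenbauer d k.1 k.2 (ip x y))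
      ∂(sphereMeasure d) = if i = k then (Module.finrank ℂ (Harm d k.1 k.2) : ℂ) else 0 := by
  split_ifs with h
  · rw [h, integral_mul_conj_zonal hd (zonal_mem_Harm hd k.1 k.2 y) y, ip_self, gegenbauer_one hd]
  · exact integral_mul_conj_eq_zero hd h (zonal_mem_Harm hd _ _ y) (zonal_mem_Harm hd _ _ y)

/-! ### Linearization of products of Gegenbauer polynomials -/

/-- The span of the `Q_{m-j,n-j}`. -/
noncomputable def gegSpan (d m n : ℕ) : Submodule ℂ (ℂ → ℂ) :=
  Submodule.span ℂ (Set.range fun j : Fin (min m n + 1) => gegenbauer d (m - j) (n - j))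

lemma gegSpan_le {m n j : ℕ} (hj : j ≤ min m n) : gegSpan d (m - j) (n - j) ≤ gegSpan d m n := by
  refine Submodule.span_le.2 ?_
  rintro _ ⟨i, rfl⟩
  refine Submodule.subset_span ⟨⟨j + i, by omega⟩, ?_⟩
  simp only [Nat.sub_sub]

lemma monomial_mem_gegSpan (hd : 1 ≤ d) (m n : ℕ) :
    (fun z => z ^ m * (starRingEnd ℂ) z ^ n) ∈ gegSpan d m n := by
  induction m using Nat.strong_induction_on generalizing n with
  | _ m ih =>
    have hlead : (gegCoeff d m n 0 : ℂ) ≠ 0 :=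
      Complex.ofReal_ne_zero.2 (gegCoeff_zero_pos hd m n).ne'
    have hQ : gegenbauer d m n ∈ gegSpan d m n :=
      Submodule.subset_span ⟨⟨0, by omega⟩, by simp⟩
    have hrest : ∑ j ∈ Finset.range (min m n), (gegCoeff d m n (j + 1) : ℂ) •
        (fun z : ℂ => z ^ (m - (j + 1)) * (starRingEnd ℂ) z ^ (n - (j + 1))) ∈ gegSpan d m n := by
      refine Submodule.sum_mem _ fun j hj => Submodule.smul_mem _ _ ?_
      have hj' := Finset.mem_range.1 hj
      exact gegSpan_le (by omega) (ih _ (by omega) _)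
    convert! (gegSpan d m n).smul_mem (gegCoeff d m n 0 : ℂ)⁻¹
      (Submodule.sub_mem _ hQ hrest) using 1
    funext z
    simp only [Pi.smul_apply, Pi.sub_apply, Finset.sum_apply, smul_eq_mul]
    rw [gegenbauer_eq, Finset.sum_range_succ']
    simp only [Nat.sub_zero]
    field_simp
    ring

lemma gegenbauer_mul_mem_gegSpan (hd : 1 ≤ d) (p q r s : ℕ) :
    (fun z => gegenbauer d p q z * gegenbauer d r s z) ∈ gegSpan d (p + r) (q + s) := by
  have h : (fun z => gegenbauer d p q z * gegenbauer d r s z) =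
      ∑ i ∈ Finset.range (min p q + 1), ∑ j ∈ Finset.range (min r s + 1),
        ((gegCoeff d p q i : ℂ) * gegCoeff d r s j) •
          (fun z : ℂ => z ^ (p + r - (i + j)) * (starRingEnd ℂ) z ^ (q + s - (i + j))) := by
    funext z
    rw [gegenbauer_eq, gegenbauer_eq, Finset.sum_mul_sum, Finset.sum_apply]
    refine Finset.sum_congr rfl fun i hi => ?_
    rw [Finset.sum_apply]
    refine Finset.sum_congr rfl fun j hj => ?_
    have hi' := Finset.mem_range.1 hi
    have hj' := Finset.mem_range.1 hj
    rw [show p + r - (i + j) = (p - i) + (r - j) by omega,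
      show q + s - (i + j) = (q - i) + (s - j) by omega, Pi.smul_apply, smul_eq_mul,
      pow_add, pow_add]
    ring
  rw [h]
  refine Submodule.sum_mem _ fun i hi => Submodule.sum_mem _ fun j hj => Submodule.smul_mem _ _ ?_
  have hi' := Finset.mem_range.1 hi
  have hj' := Finset.mem_range.1 hj
  exact gegSpan_le (by omega) (monomial_mem_gegSpan hd _ _)

lemma exists_linearization (hd : 1 ≤ d) (p q r s : ℕ) : ∃ c : ℕ → ℂ, ∀ z,
    gegenbauer d p q z * gegenbauer d r s z = ∑ j ∈ Finset.range (min (p + r) (q + s) + 1),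
      c j * gegenbauer d (p + r - j) (q + s - j) z := by
  obtain ⟨c, hc⟩ := (Submodule.mem_span_range_iff_exists_fun ℂ).1
    (gegenbauer_mul_mem_gegSpan hd p q r s)
  refine ⟨fun j => if h : j < min (p + r) (q + s) + 1 then c ⟨j, h⟩ else 0, fun z => ?_⟩
  have h := congrFun hc z
  simp only [Finset.sum_apply, Pi.smul_apply, smul_eq_mul] at h
  rw [← h, Finset.sum_range]
  refine Finset.sum_congr rfl fun j _ => ?_
  simp only [dif_pos j.2]

/-- The triple product of zonal functions, averaged over both points, is the sum of the squares
`|∫ e e' conj(e'')|²` over orthonormal bases. -/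
lemma exists_triple_integral (hd : 1 ≤ d) (a b i : ℕ × ℕ) : ∃ t : ℝ, 0 ≤ t ∧
    ∫ y, ∫ x, gegenbauer d a.1 a.2 (ip x y) * gegenbauer d b.1 b.2 (ip x y) *
      (starRingEnd ℂ) (gegenbauer d i.1 i.2 (ip x y)) ∂(sphereMeasure d) ∂(sphereMeasure d) = t ∧
    (t = 0 → ∀ f ∈ Harm d a.1 a.2, ∀ g ∈ Harm d b.1 b.2, ∀ h ∈ Harm d i.1 i.2,
      ∫ x, f x * g x * (starRingEnd ℂ) (h x) ∂(sphereMeasure d) = 0) := by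
  obtain ⟨e₁, he₁, -, hexp₁, hadd₁⟩ := exists_addition_formula hd a.1 a.2
  obtain ⟨e₂, he₂, -, hexp₂, hadd₂⟩ := exists_addition_formula hd b.1 b.2
  obtain ⟨e₃, he₃, -, hexp₃, hadd₃⟩ := exists_addition_formula hd i.1 i.2
  have hc₁ := fun u => continuous_of_mem_Harm (he₁ u)
  have hc₂ := fun u => continuous_of_mem_Harm (he₂ u)
  have hc₃ := fun u => continuous_of_mem_Harm (he₃ u)
  set E : _ → Sphere d → ℂ := fun (w : (Fin (Module.finrank ℂ (Harm d a.1 a.2)) ×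
      Fin (Module.finrank ℂ (Harm d b.1 b.2))) × Fin (Module.finrank ℂ (Harm d i.1 i.2))) x =>
    e₁ w.1.1 x * e₂ w.1.2 x * (starRingEnd ℂ) (e₃ w.2 x) with hE
  have hEc : ∀ w, Continuous (E w) := fun w => by
    have := hc₁ w.1.1
    have := hc₂ w.1.2
    have := hc₃ w.2
    simp only [hE]
    fun_prop
  set I : _ → ℂ := fun w => ∫ x, E w x ∂(sphereMeasure d) with hI
  have hkernel : ∀ x y : Sphere d, gegenbauer d a.1 a.2 (ip x y) * gegenbauer d b.1 b.2 (ip x y) *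
      (starRingEnd ℂ) (gegenbauer d i.1 i.2 (ip x y)) =
      ∑ w, E w x * (starRingEnd ℂ) (E w y) := by
    intro x y
    rw [hadd₁, hadd₂, hadd₃, map_sum, Finset.sum_mul_sum, ← Fintype.sum_prod_type',
      Finset.sum_mul_sum, ← Fintype.sum_prod_type']
    refine Finset.sum_congr rfl fun w _ => ?_
    simp only [hE, map_mul, Complex.conj_conj]
    ring
  refine ⟨∑ w, ‖I w‖ ^ 2, by positivity, ?_, ?_⟩
  · have h1 : ∀ y : Sphere d, ∫ x, gegenbauer d a.1 a.2 (ip x y) * gegenbauer d b.1 b.2 (ip x y) *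
        (starRingEnd ℂ) (gegenbauer d i.1 i.2 (ip x y)) ∂(sphereMeasure d) =
        ∑ w, I w * (starRingEnd ℂ) (E w y) := by
      intro y
      simp only [hkernel]
      rw [integral_finsetSum]
      · refine Finset.sum_congr rfl fun w _ => ?_
        rw [integral_mul_const]
      · intro w _
        have := hEc w
        exact integrable_of_continuous (by fun_prop)
    simp only [h1]
    rw [integral_finsetSum]
    · push_cast
      refine Finset.sum_congr rfl fun w _ => ?_
      rw [integral_const_mul, integral_conj, Complex.mul_conj, Complex.normSq_eq_norm_sq]
      push_cast
      rfl
    · intro w _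
      have := hEc w
      exact integrable_of_continuous (by fun_prop)
  · intro ht f hf g hg h hh
    have h0 : ∀ w, I w = 0 := by
      intro w
      have := (Finset.sum_eq_zero_iff_of_nonneg (fun w _ => sq_nonneg ‖I w‖)).1 ht w
        (Finset.mem_univ w)
      simpa using this
    have h1 : ∀ x, f x * g x * (starRingEnd ℂ) (h x) = ∑ w,
        ((∫ y, f y * (starRingEnd ℂ) (e₁ w.1.1 y) ∂(sphereMeasure d)) *
          (∫ y, g y * (starRingEnd ℂ) (e₂ w.1.2 y) ∂(sphereMeasure d)) *
          (starRingEnd ℂ) (∫ y, h y * (starRingEnd ℂ) (e₃ w.2 y) ∂(sphereMeasure d))) * E w x := by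
      intro x
      conv_lhs => rw [hexp₁ f hf x, hexp₂ g hg x, hexp₃ h hh x]
      rw [map_sum, Finset.sum_mul_sum, ← Fintype.sum_prod_type',
        Finset.sum_mul_sum, ← Fintype.sum_prod_type']
      refine Finset.sum_congr rfl fun w _ => ?_
      simp only [hE, map_mul]
      ring
    simp only [h1]
    rw [integral_finsetSum]
    · refine Finset.sum_eq_zero fun w _ => ?_
      rw [integral_const_mul]
      exact mul_eq_zero_of_right _ (h0 w)
    · intro w _
      have := hEc w
      exact integrable_of_continuous (by fun_prop)

/-! ### Strict positivity of the linearization coefficients -/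

lemma forms_mem_harmPoly {a b : Fin d → ℂ} {p q : ℕ} (h : p = 0 ∨ q = 0 ∨ ∑ i, a i * b i = 0) :
    zForm a ^ p * zbarForm b ^ q ∈ harmPoly d p q := by
  refine mem_harmPoly.2 ⟨forms_pow_mem a b p q, ?_⟩
  rw [laplacian_forms]
  rcases h with h | h | h <;> simp [h]

lemma sum_single_mul_single (i j : Fin d) :
    ∑ k, (Pi.single i 1 : Fin d → ℂ) k * (Pi.single j 1 : Fin d → ℂ) k =
      if i = j then 1 else 0 := by
  simp [Pi.single_apply, eq_comm]

lemma sum_single_mul_add_single (i j k : Fin d) :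
    ∑ l, (Pi.single i 1 : Fin d → ℂ) l * (Pi.single j 1 + Pi.single k 1 : Fin d → ℂ) l =
      (if i = j then 1 else 0) + if i = k then 1 else 0 := by
  simp only [Pi.add_apply, mul_add, Finset.sum_add_distrib, sum_single_mul_single]

lemma sum_add_single_mul_single (i j k : Fin d) :
    ∑ l, (Pi.single j 1 + Pi.single k 1 : Fin d → ℂ) l * (Pi.single i 1 : Fin d → ℂ) l =
      (if i = j then 1 else 0) + if i = k then 1 else 0 := by
  rw [← sum_single_mul_add_single]
  simp only [mul_comm]

lemma finrank_Harm_pos (hd : 1 ≤ d) {p q : ℕ} (h : 2 ≤ d ∨ p = 0 ∨ q = 0) :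
    0 < Module.finrank ℂ (Harm d p q) := by
  rw [finrank_Harm_eq hd]
  let i : Fin d := ⟨0, hd⟩
  let j : Fin d := ⟨d - 1, by omega⟩
  have hmem : zForm (Pi.single i 1) ^ p * zbarForm (Pi.single j 1) ^ q ∈ harmPoly d p q := by
    apply forms_mem_harmPoly
    rcases h with h | h | h
    · right; right
      have hij : i ≠ j := by
        intro hij
        have := congrArg Fin.val hij
        simp only [i, j] at this
        omega
      rw [sum_single_mul_single, if_neg hij]
    · exact Or.inl h
    · exact Or.inr (Or.inl h)
  refine Module.finrank_pos_iff_exists_ne_zero.2 ⟨⟨_, hmem⟩, fun h0 => ?_⟩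
  have := congrArg (bieval (Pi.single i 1) (Pi.single j 1)) (congrArg Subtype.val h0)
  simp [bieval_zForm, bieval_zbarForm, sum_single_mul_single] at this

lemma laplacian_iterate_normSqPoly_pow_add_mul (k l : ℕ) {p q : ℕ} {f : BiPoly d}
    (hf : f ∈ harmPoly d p q) :
    ∃ c : ℂ, (laplacian d ^ k) (normSqPoly d ^ (l + k) * f) = c • (normSqPoly d ^ l * f) := by
  induction k with
  | zero => exact ⟨1, by simp⟩
  | succ k ih =>
    obtain ⟨c, hc⟩ := ih
    refine ⟨(((l + k + 1) * (d + p + q + (l + k)) : ℕ) : ℂ) * c, ?_⟩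
    rw [pow_succ, Module.End.mul_apply, ← add_assoc, laplacian_normSqPoly_pow_mul_harm (l + k) hf,
      map_smul, hc, smul_smul]

/-- The Laplacian of the product of two powers of linear forms, which are harmonic and
are normalised with respect to each other. -/
lemma laplacian_forms_mul_forms {α β γ ε : Fin d → ℂ} (h1 : ∑ i, α i * β i = 0)
    (h2 : ∑ i, γ i * ε i = 0) (h3 : ∑ i, α i * ε i = 1) (h4 : ∑ i, β i * γ i = 1) (p q r s : ℕ) :
    laplacian d ((zForm α ^ p * zbarForm β ^ q) * (zForm γ ^ r * zbarForm ε ^ s)) =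
      ((p * s : ℕ) : ℂ) •
        ((zForm α ^ (p - 1) * zbarForm β ^ q) * (zForm γ ^ r * zbarForm ε ^ (s - 1))) +
      ((q * r : ℕ) : ℂ) •
        ((zForm α ^ p * zbarForm β ^ (q - 1)) * (zForm γ ^ (r - 1) * zbarForm ε ^ s)) := by
  rw [laplacian_mul, laplacian_forms, laplacian_forms, h1, h2, mul_zero, mul_zero, map_zero,
    zero_mul, zero_mul, zero_mul, mul_zero, add_zero, zero_add, Finset.sum_add_distrib]
  congr 1
  · rw [← mul_one ((p * s : ℕ) : ℂ), ← h3, Finset.mul_sum, Finset.sum_smul]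
    refine Finset.sum_congr rfl fun i _ => ?_
    rw [pderiv_inl_forms, pderiv_inr_forms, MvPolynomial.smul_eq_C_mul]
    simp only [Nat.cast_mul, map_mul]
    ring
  · rw [← mul_one ((q * r : ℕ) : ℂ), ← h4, Finset.mul_sum, Finset.sum_smul]
    refine Finset.sum_congr rfl fun i _ => ?_
    rw [pderiv_inl_forms, pderiv_inr_forms, MvPolynomial.smul_eq_C_mul]
    simp only [Nat.cast_mul, map_mul]
    ring

lemma bieval_laplacian_iterate_pos {α β γ ε z w : Fin d → ℂ} (h1 : ∑ i, α i * β i = 0)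
    (h2 : ∑ i, γ i * ε i = 0) (h3 : ∑ i, α i * ε i = 1) (h4 : ∑ i, β i * γ i = 1)
    (hα : ∑ i, α i * z i = 1) (hβ : ∑ i, β i * w i = 1) (hγ : ∑ i, γ i * z i = 1)
    (hε : ∑ i, ε i * w i = 1) (j p q r s : ℕ) :
    ∃ N : ℕ, bieval z w ((laplacian d ^ j)
      ((zForm α ^ p * zbarForm β ^ q) * (zForm γ ^ r * zbarForm ε ^ s))) = N ∧
      (j ≤ min p s + min q r → 0 < N) := by
  induction j generalizing p q r s with
  | zero => exact ⟨1, by simp [bieval_zForm, bieval_zbarForm, hα, hβ, hγ, hε], by simp⟩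
  | succ j ih =>
    obtain ⟨N₁, hN₁, hpos₁⟩ := ih (p - 1) q r (s - 1)
    obtain ⟨N₂, hN₂, hpos₂⟩ := ih p (q - 1) (r - 1) s
    refine ⟨p * s * N₁ + q * r * N₂, ?_, fun hj => ?_⟩
    · rw [pow_succ, Module.End.mul_apply, laplacian_forms_mul_forms h1 h2 h3 h4, map_add, map_smul,
        map_smul, map_add, map_smul, map_smul, hN₁, hN₂]
      simp
    · by_cases hps : 0 < p ∧ 0 < s
      · have := hpos₁ (by omega)
        have := hps.1
        have := hps.2
        positivity
      · have hqr : 0 < q ∧ 0 < r := by omega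
        have := hpos₂ (by omega)
        have := hqr.1
        have := hqr.2
        positivity

/-- For `d ≥ 3` the product `H(p,q) H(r,s)` is not orthogonal to any of the admissible
`H(p+r-j,q+s-j)`. Take `f = α^p β^q` and `g = γ^r ε^s` with `α ⊥ β` and
`γ ⊥ ε`. If the component in question vanished then `Δ^j(fg)` would be a multiple of
`∑ z_i w_i`, but in dimension three the forms can be chosen such that `Δ^j(fg)` is
positive at some zero of `∑ z_i w_i`. -/
lemma exists_mul_not_orthogonal (hd : 3 ≤ d) {p q r s j : ℕ} (hj : j ≤ min p s + min q r) :
    ∃ f ∈ Harm d p q, ∃ g ∈ Harm d r s, ∃ h ∈ Harm d (p + r - j) (q + s - j),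
      ∫ x, f x * g x * (starRingEnd ℂ) (h x) ∂(sphereMeasure d) ≠ 0 := by
  have hd1 : 1 ≤ d := by omega
  let i₀ : Fin d := ⟨0, by omega⟩
  let i₁ : Fin d := ⟨1, by omega⟩
  let i₂ : Fin d := ⟨2, by omega⟩
  have h01 : i₀ ≠ i₁ := by simp [i₀, i₁]
  have h02 : i₀ ≠ i₂ := by simp [i₀, i₂]
  have h12 : i₁ ≠ i₂ := by simp [i₁, i₂]
  let α : Fin d → ℂ := Pi.single i₀ 1
  let γ : Fin d → ℂ := Pi.single i₁ 1
  let w : Fin d → ℂ := Pi.single i₂ 1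
  let β : Fin d → ℂ := Pi.single i₁ 1 + Pi.single i₂ 1
  let ε : Fin d → ℂ := Pi.single i₀ 1 + Pi.single i₂ 1
  let z : Fin d → ℂ := Pi.single i₀ 1 + Pi.single i₁ 1
  have hαβ : ∑ i, α i * β i = 0 := by
    rw [sum_single_mul_add_single]; simp [h01, h02]
  have hγε : ∑ i, γ i * ε i = 0 := by
    rw [sum_single_mul_add_single]; simp [h01.symm, h12]
  have hF := forms_mem_harmPoly (p := p) (q := q) (Or.inr (Or.inr hαβ))
  have hG := forms_mem_harmPoly (p := r) (q := s) (Or.inr (Or.inr hγε))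
  set F := zForm α ^ p * zbarForm β ^ q
  set G := zForm γ ^ r * zbarForm ε ^ s
  obtain ⟨N, hN, hpos⟩ := bieval_laplacian_iterate_pos (z := z) (w := w) hαβ hγε
    (by rw [sum_single_mul_add_single]; simp [h02])
    (by rw [sum_add_single_mul_single]; simp [h12])
    (by rw [sum_single_mul_add_single]; simp [h01])
    (by rw [sum_add_single_mul_single]; simp [h12.symm])
    (by rw [sum_single_mul_add_single]; simp [h01.symm])
    (by rw [sum_add_single_mul_single]; simp [h02.symm])
    j p q r s
  have hzw : bieval z w (normSqPoly d) = 0 := by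
    simp only [normSqPoly, map_sum, map_mul, bieval_X_inl, bieval_X_inr]
    rw [sum_add_single_mul_single]
    simp [h02.symm, h12.symm]
  obtain ⟨h, hh, hsum⟩ := exists_harmonic_decomposition hd1 (min (p + r) (q + s) + 1) (by simp)
    (by simp) (homPoly_mul hF.1 hG.1) (laplacian_iterate_eq_zero (homPoly_mul hF.1 hG.1))
  have hjm : j < min (p + r) (q + s) + 1 := by omega
  refine ⟨_, ⟨F, hF, rfl⟩, _, ⟨G, hG, rfl⟩, _, ⟨h j, hh j hjm, rfl⟩, fun h0 => ?_⟩
  -- the integral is the square of the norm of the component `h j`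
  have h1 : ∫ x, restrictSphere d F x * restrictSphere d G x *
      (starRingEnd ℂ) (restrictSphere d (h j) x) ∂(sphereMeasure d) =
      ∫ x, restrictSphere d (h j) x * (starRingEnd ℂ) (restrictSphere d (h j) x)
        ∂(sphereMeasure d) := by
    have h2 : ∀ x, restrictSphere d F x * restrictSphere d G x *
        (starRingEnd ℂ) (restrictSphere d (h j) x) =
        restrictSphere d (F * G) x * (starRingEnd ℂ) (restrictSphere d (h j) x) := by
      intro x
      rw [restrictSphere_mul F G, Pi.mul_apply]
    simp only [h2]
    rw [integral_mul_conj_restrictSphere, integral_mul_conj_restrictSphere, hsum, Finset.sum_mul,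
      map_sum, Finset.sum_eq_single_of_mem j (Finset.mem_range.2 hjm)]
    · rw [← integral_mul_conj_restrictSphere, ← integral_mul_conj_restrictSphere,
        restrictSphere_normSqPoly_pow_mul]
    · intro i hi hij
      have hi' := Finset.mem_range.1 hi
      rw [← integral_mul_conj_restrictSphere, restrictSphere_normSqPoly_pow_mul]
      refine integral_mul_conj_eq_zero hd1 (i := (p + r - i, q + s - i))
        (j := (p + r - j, q + s - j)) ?_ ⟨_, hh i hi', rfl⟩ ⟨_, hh j hjm, rfl⟩
      intro heq
      have := congrArg Prod.fst heq
      simp only at this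
      omega
  have h2 : h j = 0 := by
    refine eq_zero_of_restrictSphere_eq_zero hd1 (hh j hjm).1 ?_
    refine eq_zero_of_integral_mul_conj_self (continuous_restrictSphere _) ?_
    rw [← h1]
    exact h0
  have h3 : bieval z w ((laplacian d ^ j) (F * G)) = 0 := by
    rw [hsum, map_sum, map_sum]
    refine Finset.sum_eq_zero fun i hi => ?_
    have hi' := Finset.mem_range.1 hi
    rcases lt_trichotomy i j with hij | rfl | hij
    · rw [laplacian_iterate_normSqPoly_pow_mul_of_lt hij (hh i hi'), map_zero]
    · rw [h2, mul_zero, map_zero, map_zero]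
    · obtain ⟨l, rfl⟩ := Nat.exists_eq_add_of_lt hij
      obtain ⟨c, hc⟩ := laplacian_iterate_normSqPoly_pow_add_mul j (l + 1) (hh _ hi')
      rw [show j + l + 1 = l + 1 + j by ring] at hc ⊢
      rw [hc, map_smul, map_mul, map_pow, hzw]
      simp
  rw [h3] at hN
  exact (hpos hj).ne (Nat.cast_injective (R := ℂ) (by simpa using hN))

/-! ### The linearization formula -/

lemma mem_indexMul {a b i : ℕ × ℕ} : i ∈ indexMul a b ↔
    ∃ j ≤ min a.1 b.2 + min a.2 b.1, (a.1 + b.1 - j, a.2 + b.2 - j) = i := by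
  simp [indexMul]

/-- The coefficients of the linearization formula of the Gegenbauer polynomials are nonnegative;
for `d ≥ 3` all the admissible ones are positive. -/
lemma exists_nonneg_linearization (hd : 1 ≤ d) (a b : ℕ × ℕ) :
    ∃ F : ℕ × ℕ → ℝ, (∀ i, 0 ≤ F i) ∧ (∀ i ∉ indexMul a b, F i = 0) ∧
      (∀ x y : Sphere d, gegenbauer d a.1 a.2 (ip x y) * gegenbauer d b.1 b.2 (ip x y) =
        ∑ i ∈ indexMul a b, (F i : ℂ) * gegenbauer d i.1 i.2 (ip x y)) ∧
      (3 ≤ d → ∀ i ∈ indexMul a b, 0 < F i) := by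
  have := isProbabilityMeasure_sphereMeasure hd
  choose t ht0 ht htz using fun i => exists_triple_integral hd a b i
  obtain ⟨c, hc⟩ := exists_linearization hd a.1 a.2 b.1 b.2
  set M := min (a.1 + b.1) (a.2 + b.2) with hM
  set ι : ℕ → ℕ × ℕ := fun j => (a.1 + b.1 - j, a.2 + b.2 - j) with hι
  set N : ℕ × ℕ → ℕ := fun i => Module.finrank ℂ (Harm d i.1 i.2) with hN
  have hι_inj : ∀ j ≤ M, ∀ k ≤ M, ι j = ι k → j = k := by
    intro j hj k hk h
    have := congrArg Prod.fst h
    simp only [hι] at this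
    omega
  -- integrating the expansion against `Q_i` isolates its coefficient
  have hsingle : ∀ j ≤ M, ∀ y : Sphere d,
      ∫ x, gegenbauer d a.1 a.2 (ip x y) * gegenbauer d b.1 b.2 (ip x y) *
        (starRingEnd ℂ) (gegenbauer d (ι j).1 (ι j).2 (ip x y)) ∂(sphereMeasure d) =
        c j * N (ι j) := by
    intro j hj y
    simp only [hc, Finset.sum_mul, mul_assoc]
    rw [integral_finsetSum]
    · simp only [integral_const_mul]
      rw [Finset.sum_eq_single_of_mem j (Finset.mem_range.2 (by omega))]
      · rw [integral_zonal_mul_conj_zonal hd (ι j) (ι j), if_pos rfl]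
      · intro k hk hkj
        have hk' := Finset.mem_range.1 hk
        rw [integral_zonal_mul_conj_zonal hd (ι k) (ι j), if_neg, mul_zero]
        exact fun h => hkj (hι_inj k (by omega) j hj h)
    · intro k _
      have h1 := continuous_zonal hd (ι k).1 (ι k).2 y
      have h2 := continuous_zonal hd (ι j).1 (ι j).2 y
      exact integrable_of_continuous (by fun_prop)
  have hcN : ∀ j ≤ M, c j * N (ι j) = t (ι j) := by
    intro j hj
    rw [← ht]
    simp only [hsingle j hj]
    simp
  have hterm : ∀ j ≤ M, ∀ x y : Sphere d, c j * gegenbauer d (ι j).1 (ι j).2 (ip x y) =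
      ((t (ι j) / N (ι j) : ℝ) : ℂ) * gegenbauer d (ι j).1 (ι j).2 (ip x y) := by
    intro j hj x y
    by_cases h : N (ι j) = 0
    -- for `d = 1` many of the spaces are zero, and so are their kernels on the sphere
    · rw [gegenbauer_eq_zero_of_finrank hd h, mul_zero, mul_zero]
    · have h' : (N (ι j) : ℂ) ≠ 0 := Nat.cast_ne_zero.2 h
      push_cast
      rw [← hcN j hj, mul_div_cancel_right₀ _ h']
  have hzero : ∀ j ≤ M, ι j ∉ indexMul a b → ∀ x y : Sphere d,
      c j * gegenbauer d (ι j).1 (ι j).2 (ip x y) = 0 := by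
    intro j hj hnot x y
    by_cases h : N (ι j) = 0
    · rw [gegenbauer_eq_zero_of_finrank hd h, mul_zero]
    · have h' : (N (ι j) : ℂ) ≠ 0 := Nat.cast_ne_zero.2 h
      have h1 := (continuous_and_orthogonal_of_mem_polySpace hd hnot
        (zonal_mem_Harm hd (ι j).1 (ι j).2 y)
        (mul_mem_polySpace hd (zonal_mem_Harm hd a.1 a.2 y) (zonal_mem_Harm hd b.1 b.2 y))).2
      simp only [Pi.mul_apply] at h1
      rw [hsingle j hj] at h1
      rw [(mul_eq_zero.1 h1).resolve_right h', zero_mul]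
  have hsumι : ∀ g : ℕ × ℕ → ℂ, ∑ i ∈ indexMul a b, g i =
      ∑ j ∈ Finset.range (min a.1 b.2 + min a.2 b.1 + 1), g (ι j) := by
    intro g
    refine Finset.sum_image fun j hj k hk h => ?_
    have hj' := Finset.mem_range.1 hj
    have hk' := Finset.mem_range.1 hk
    exact hι_inj j (by omega) k (by omega) h
  have hdim : ∀ i : ℕ × ℕ, 2 ≤ d → 0 < N i := fun i h => finrank_Harm_pos hd (Or.inl h)
  refine ⟨fun i => if i ∈ indexMul a b then t i / N i else 0, fun i => ?_, fun i hi => if_neg hi,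
    fun x y => ?_, fun h3 i hi => ?_⟩
  · dsimp only
    split_ifs
    · exact div_nonneg (ht0 i) (Nat.cast_nonneg _)
    · exact le_rfl
  · have hμ : min a.1 b.2 + min a.2 b.1 ≤ M := by omega
    rw [hc, ← Finset.sum_subset (Finset.range_mono (Nat.succ_le_succ hμ))]
    · rw [hsumι]
      refine Finset.sum_congr rfl fun j hj => ?_
      have hj' := Finset.mem_range.1 hj
      have hmem : ι j ∈ indexMul a b := mem_indexMul.2 ⟨j, by omega, rfl⟩
      simp only [if_pos hmem]
      exact hterm j (by omega) x y
    · intro j hj hnot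
      have hj' := Finset.mem_range.1 hj
      refine hzero j (by omega) (fun hmem => ?_) x y
      obtain ⟨k, hk, hkj⟩ := mem_indexMul.1 hmem
      rw [Finset.mem_range] at hnot
      have := hι_inj k (by omega) j (by omega) hkj
      omega
  · dsimp only
    rw [if_pos hi]
    refine div_pos ((ht0 i).lt_of_ne fun h0 => ?_) (Nat.cast_pos.2 (hdim i (by omega)))
    obtain ⟨j, hj, rfl⟩ := mem_indexMul.1 hi
    obtain ⟨f, hf, g, hg, h, hh, hne⟩ := exists_mul_not_orthogonal h3 hj
    exact hne (htz _ h0.symm f hf g hg h hh)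

/-! ### Nonnegative potentials -/

lemma mem_setMul {E F : Finset (ℕ × ℕ)} {i : ℕ × ℕ} :
    i ∈ setMul E F ↔ ∃ a ∈ E, ∃ b ∈ F, i ∈ indexMul a b := by
  simp [setMul]

lemma gegenbauerSum_rev (E : Finset (ℕ × ℕ)) (z : ℂ) :
    gegenbauerSum d (rev E) z = (starRingEnd ℂ) (gegenbauerSum d E z) := by
  rw [gegenbauerSum, gegenbauerSum, rev, Finset.sum_image (fun _ _ _ _ h => Prod.swap_injective h),
    map_sum]
  exact Finset.sum_congr rfl fun i _ => (gegenbauer_conj d i.1 i.2 z).symm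

lemma norm_gegenbauerSum_sq (E : Finset (ℕ × ℕ)) (z : ℂ) :
    ((‖gegenbauerSum d E z‖ ^ 2 : ℝ) : ℂ) = gegenbauerSum d E z * gegenbauerSum d (rev E) z := by
  rw [gegenbauerSum_rev, Complex.mul_conj, Complex.normSq_eq_norm_sq]

/-- The expansion of `|Q_E|²` in the Gegenbauer polynomials. -/
lemma exists_potential (hd : 1 ≤ d) (E : Finset (ℕ × ℕ)) :
    ∃ F : ℕ × ℕ → ℝ, (∀ i, 0 ≤ F i) ∧ (∀ i ∉ setMul E (rev E), F i = 0) ∧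
      (∀ x y : Sphere d, ((‖gegenbauerSum d E (ip x y)‖ ^ 2 : ℝ) : ℂ) =
        ∑ i ∈ setMul E (rev E), (F i : ℂ) * gegenbauer d i.1 i.2 (ip x y)) ∧
      (3 ≤ d → ∀ i ∈ setMul E (rev E), 0 < F i) := by
  choose F hF0 hFz hF hFpos using fun a b => exists_nonneg_linearization hd a b
  have hsub : ∀ a ∈ E, ∀ b ∈ rev E, indexMul a b ⊆ setMul E (rev E) :=
    fun a ha b hb i hi => mem_setMul.2 ⟨a, ha, b, hb, hi⟩
  refine ⟨fun i => ∑ a ∈ E, ∑ b ∈ rev E, F a b i,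
    fun i => Finset.sum_nonneg fun a _ => Finset.sum_nonneg fun b _ => hF0 a b i,
    fun i hi => Finset.sum_eq_zero fun a ha => Finset.sum_eq_zero fun b hb =>
      hFz a b i fun h => hi (hsub a ha b hb h), fun x y => ?_, fun h3 i hi => ?_⟩
  · rw [norm_gegenbauerSum_sq, gegenbauerSum, gegenbauerSum, Finset.sum_mul_sum]
    push_cast
    simp only [Finset.sum_mul]
    conv_rhs => rw [Finset.sum_comm]
    refine Finset.sum_congr rfl fun a ha => ?_
    conv_rhs => rw [Finset.sum_comm]
    refine Finset.sum_congr rfl fun b hb => ?_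
    rw [hF, Finset.sum_subset (hsub a ha b hb)]
    intro i _ hi
    rw [hFz a b i hi, Complex.ofReal_zero, zero_mul]
  · obtain ⟨a, ha, b, hb, hab⟩ := mem_setMul.1 hi
    exact Finset.sum_pos' (fun a _ => Finset.sum_nonneg fun b _ => hF0 a b i)
      ⟨a, ha, Finset.sum_pos' (fun b _ => hF0 a b i) ⟨b, hb, hFpos a b h3 i hab⟩⟩

lemma isPotential_of_expansion {G : ℂ → ℂ} {τ : Finset (ℕ × ℕ)} {F : ℕ × ℕ → ℝ}
    (h0 : ∀ i, 0 ≤ F i) (hz : ∀ i ∉ τ, F i = 0)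
    (h : ∀ x y : Sphere d, G (ip x y) = ∑ i ∈ τ, (F i : ℂ) * gegenbauer d i.1 i.2 (ip x y)) :
    IsPotential d G (τ.filter fun i => 0 < F i) := by
  have hτ : ∀ i, F i ≠ 0 → i ∈ τ := fun i hi => by_contra fun h => hi (hz i h)
  refine ⟨Finsupp.onFinset τ F hτ, h0, fun x y => ?_, fun i _ => ?_⟩
  · rw [h]
    refine (Finset.sum_subset Finsupp.support_onFinset_subset fun i _ hi => ?_).symm
    have hi' : F i = 0 := Finsupp.notMem_support_iff.1 hi
    rw [hi', Complex.ofReal_zero, zero_mul]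
  · rw [Finset.mem_filter, Finsupp.onFinset_apply]
    exact ⟨fun hi => ⟨hτ i hi.ne', hi⟩, fun hi => hi.2⟩

/-! ### Designs -/

lemma IsDesign.integral_eq {n : ℕ} {P : Submodule ℂ (Sphere d → ℂ)} {v : Fin n → Sphere d}
    (hv : IsDesign P v) {f : Sphere d → ℂ} (hf : f ∈ P) :
    ∑ j, f (v j) = n * ∫ x, f x ∂(sphereMeasure d) := by
  have : (n : ℂ) ≠ 0 := Nat.cast_ne_zero.2 hv.1.ne'
  rw [hv.2 f hf]
  field_simp

lemma gegenbauerSum_one (hd : 1 ≤ d) (E : Finset (ℕ × ℕ)) :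
    gegenbauerSum d E 1 = ((∑ i ∈ E, Module.finrank ℂ (Harm d i.1 i.2) : ℕ) : ℂ) := by
  rw [gegenbauerSum, Nat.cast_sum]
  exact Finset.sum_congr rfl fun i _ => gegenbauer_one hd i.1 i.2

/-- The reproducing kernel of `P_E` has the square norm `dim P_E`. -/
lemma integral_norm_gegenbauerSum_sq (hd : 1 ≤ d) (E : Finset (ℕ × ℕ)) (y : Sphere d) :
    ∫ x, ((‖gegenbauerSum d E (ip x y)‖ ^ 2 : ℝ) : ℂ) ∂(sphereMeasure d) =
      ((∑ i ∈ E, Module.finrank ℂ (Harm d i.1 i.2) : ℕ) : ℂ) := by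
  have h : ∀ x : Sphere d, ((‖gegenbauerSum d E (ip x y)‖ ^ 2 : ℝ) : ℂ) =
      ∑ i ∈ E, ∑ k ∈ E, gegenbauer d i.1 i.2 (ip x y) *
        (starRingEnd ℂ) (gegenbauer d k.1 k.2 (ip x y)) := by
    intro x
    rw [norm_gegenbauerSum_sq, gegenbauerSum_rev, gegenbauerSum, map_sum, Finset.sum_mul_sum]
  have hint : ∀ i k : ℕ × ℕ, Integrable (fun x => gegenbauer d i.1 i.2 (ip x y) *
        (starRingEnd ℂ) (gegenbauer d k.1 k.2 (ip x y))) (sphereMeasure d) := by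
    intro i k
    have h1 := continuous_zonal hd i.1 i.2 y
    have h2 := continuous_zonal hd k.1 k.2 y
    exact integrable_of_continuous (by fun_prop)
  simp only [h]
  rw [integral_finsetSum _ fun i _ => integrable_finsetSum _ fun k _ => hint i k, Nat.cast_sum]
  refine Finset.sum_congr rfl fun i hi => ?_
  rw [integral_finsetSum _ fun k _ => hint i k]
  simp only [integral_zonal_mul_conj_zonal hd]
  simp [hi]

/-- The values of the potential `|Q_E|²` of a design at a fixed point of the sphere
add up to `n dim P_E`. -/
lemma IsDesign.sum_norm_gegenbauerSum_sq (hd : 1 ≤ d) {E : Finset (ℕ × ℕ)} {n : ℕ}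
    {v : Fin n → Sphere d} (hv : IsDesign (polySpace d (setMul E (rev E))) v) (y : Sphere d) :
    ∑ j, ‖gegenbauerSum d E (ip (v j) y)‖ ^ 2 =
      (n : ℝ) * (∑ i ∈ E, Module.finrank ℂ (Harm d i.1 i.2) : ℕ) := by
  obtain ⟨F, -, -, hF, -⟩ := exists_potential hd E
  have hmem : (fun x => ((‖gegenbauerSum d E (ip x y)‖ ^ 2 : ℝ) : ℂ)) ∈
      polySpace d (setMul E (rev E)) := by
    have : (fun x => ((‖gegenbauerSum d E (ip x y)‖ ^ 2 : ℝ) : ℂ)) =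
        ∑ i ∈ setMul E (rev E), (F i : ℂ) • fun x => gegenbauer d i.1 i.2 (ip x y) := by
      funext x
      rw [hF, Finset.sum_apply]
      rfl
    rw [this]
    exact Submodule.sum_mem _ fun i hi =>
      Submodule.smul_mem _ _ (Harm_le_polySpace hi (zonal_mem_Harm hd i.1 i.2 y))
  have h := hv.integral_eq hmem
  rw [integral_norm_gegenbauerSum_sq hd] at h
  exact_mod_cast h

lemma IsDesign.le_and_eq_iff (hd : 1 ≤ d) {E : Finset (ℕ × ℕ)} {n : ℕ} {v : Fin n → Sphere d}
    (hv : IsDesign (polySpace d (setMul E (rev E))) v) :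
    (∑ i ∈ E, Module.finrank ℂ (Harm d i.1 i.2) ≤ n) ∧
    (0 < ∑ i ∈ E, Module.finrank ℂ (Harm d i.1 i.2) →
      (n = ∑ i ∈ E, Module.finrank ℂ (Harm d i.1 i.2) ↔
        Function.Injective v ∧ ∀ α ∈ angles v, gegenbauerSum d E α = 0)) := by
  set N := ∑ i ∈ E, Module.finrank ℂ (Harm d i.1 i.2) with hN
  have hn := hv.1
  have hsum : ∀ k, ∑ j, ‖gegenbauerSum d E (ip (v j) (v k))‖ ^ 2 = (n : ℝ) * N := fun k =>
    hv.sum_norm_gegenbauerSum_sq hd (v k)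
  have hdiag : ∀ j k, v j = v k → ‖gegenbauerSum d E (ip (v j) (v k))‖ ^ 2 = (N : ℝ) ^ 2 := by
    intro j k hjk
    rw [hjk, ip_self, gegenbauerSum_one hd, Complex.norm_natCast]
  have hsplit : ∀ k, (n : ℝ) * N = (N : ℝ) ^ 2 +
      ∑ j ∈ Finset.univ.erase k, ‖gegenbauerSum d E (ip (v j) (v k))‖ ^ 2 := by
    intro k
    rw [← hsum k, ← Finset.add_sum_erase _ _ (Finset.mem_univ k), hdiag k k rfl]
  have hle : N ≤ n := by
    rcases Nat.eq_zero_or_pos N with h0 | hpos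
    · omega
    have h1 := hsplit ⟨0, hn⟩
    have h2 : 0 ≤ ∑ j ∈ Finset.univ.erase ⟨0, hn⟩,
      ‖gegenbauerSum d E (ip (v j) (v ⟨0, hn⟩))‖ ^ 2 := Finset.sum_nonneg fun _ _ => sq_nonneg _
    have h3 : (N : ℝ) * N ≤ n * N := by nlinarith
    exact_mod_cast le_of_mul_le_mul_right h3 (Nat.cast_pos.2 hpos)
  refine ⟨hle, fun hpos => ⟨fun h => ?_, fun h => ?_⟩⟩
  · have hoff : ∀ j k, j ≠ k → gegenbauerSum d E (ip (v j) (v k)) = 0 := by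
      intro j k hjk
      have h1 := hsplit k
      rw [congrArg (Nat.cast (R := ℝ)) h, sq, left_eq_add,
        Finset.sum_eq_zero_iff_of_nonneg fun _ _ => sq_nonneg _] at h1
      simpa using h1 j (Finset.mem_erase.2 ⟨hjk, Finset.mem_univ j⟩)
    refine ⟨fun j k hjk => by_contra fun hne => ?_, ?_⟩
    · have h1 := hdiag j k hjk
      rw [hoff j k hne, norm_zero] at h1
      have h2 : (0 : ℝ) < N := Nat.cast_pos.2 hpos
      nlinarith
    · rintro _ ⟨j, k, hjk, rfl⟩
      exact hoff j k fun h => hjk (congrArg v h)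
  · have h1 := hsplit ⟨0, hn⟩
    rw [Finset.sum_eq_zero, add_zero, sq] at h1
    · exact_mod_cast mul_right_cancel₀ (Nat.cast_ne_zero.2 hpos.ne') h1
    · intro j hj
      rw [h.2 _ ⟨j, ⟨0, hn⟩, fun hjk => Finset.ne_of_mem_erase hj (h.1 hjk), rfl⟩, norm_zero]
      norm_num

lemma Hom_le_projSpace (t : ℕ) : Hom d t t ≤ projSpace d t := by
  refine (Submodule.map_mono (homPoly_le_span t)).trans ?_
  rw [Submodule.map_span, Submodule.span_le]
  rintro _ ⟨_, ⟨u, rfl⟩, rfl⟩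
  exact Submodule.subset_span
    ⟨WithLp.toLp 2 u, funext fun x => (restrictSphere_forms_pow u t x).symm⟩

/-- Evaluation at the points of a spherical `(p+q,p+q)`-design is injective on `Hom(p,q)`, as
the squares `|f|²` are integrated exactly. -/
lemma IsDesign.finrank_Hom_le {p q n : ℕ} {v : Fin n → Sphere d}
    (hv : IsDesign (projSpace d (p + q)) v) : Module.finrank ℂ (Hom d p q) ≤ n := by
  have hinj : Function.Injective ((LinearMap.funLeft ℂ ℂ v).domRestrict (Hom d p q)) := by
    rw [← LinearMap.ker_eq_bot, LinearMap.ker_eq_bot']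
    intro f hf
    refine Subtype.ext (eq_zero_of_integral_mul_conj_self (continuous_of_mem_Hom f.2) ?_)
    have hmem : f.1 * (fun x => (starRingEnd ℂ) (f.1 x)) ∈ projSpace d (p + q) := by
      apply Hom_le_projSpace
      have := mul_mem_Hom f.2 (conj_mem_Hom f.2)
      rwa [add_comm q p] at this
    have h0 : ∀ j, f.1 (v j) = 0 := fun j => congrFun hf j
    have := hv.2 _ hmem
    simpa [h0] using this
  simpa using LinearMap.finrank_le_finrank_of_injective hinj

/-! ### Comparison of the bounds -/

/-- Moving the two degrees closer together increases the product of the dimensions. -/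
lemma choose_mul_choose_le (e a b : ℕ) (h : a ≤ b) :
    (a + e).choose e * (b + 1 + e).choose e ≤ (a + 1 + e).choose e * (b + e).choose e ∧
    (1 ≤ e → a < b →
      (a + e).choose e * (b + 1 + e).choose e < (a + 1 + e).choose e * (b + e).choose e) := by
  have hrec : ∀ m : ℕ, (m + 1 + e).choose e * (m + 1) = (m + e).choose e * (m + 1 + e) := by
    intro m
    have := Nat.choose_mul_succ_eq (m + e) e
    rw [show m + e + 1 - e = m + 1 by omega, show m + e + 1 = m + 1 + e by omega] at this
    exact this.symm
  have ha := hrec a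
  have hb := hrec b
  set A := (a + e).choose e
  set B := (b + e).choose e
  have hA : 0 < A := Nat.choose_pos (by omega)
  have hB : 0 < B := Nat.choose_pos (by omega)
  have h1 : A * (b + 1 + e).choose e * ((a + 1) * (b + 1)) = A * B * ((a + 1) * (b + 1 + e)) := by
    linear_combination A * (a + 1) * hb
  have h2 : (a + 1 + e).choose e * B * ((a + 1) * (b + 1)) = A * B * ((a + 1 + e) * (b + 1)) := by
    linear_combination B * (b + 1) * ha
  constructor
  · refine Nat.le_of_mul_le_mul_right (c := (a + 1) * (b + 1)) ?_ (by positivity)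
    rw [h1, h2]
    refine Nat.mul_le_mul_left _ ?_
    nlinarith [Nat.mul_le_mul_left e h]
  · intro he hlt
    refine Nat.lt_of_mul_lt_mul_right (a := (a + 1) * (b + 1)) ?_
    rw [h1, h2]
    refine Nat.mul_lt_mul_of_pos_left ?_ (by positivity)
    nlinarith [Nat.mul_lt_mul_of_pos_left hlt he]

lemma choose_mul_choose_le_balanced (e p q : ℕ) (h : p ≤ q) :
    (p + e).choose e * (q + e).choose e ≤
      ((p + q) / 2 + e).choose e * ((p + q) - (p + q) / 2 + e).choose e := by
  obtain ⟨m, hm⟩ : ∃ m, (p + q) / 2 = p + m := ⟨(p + q) / 2 - p, by omega⟩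
  induction m generalizing p q with
  | zero => rw [hm, show p + q - (p + 0) = q by omega, add_zero]
  | succ m ih =>
    obtain ⟨q, rfl⟩ : ∃ q', q = q' + 1 := ⟨q - 1, by omega⟩
    refine (choose_mul_choose_le e p q (by omega)).1.trans ?_
    have := ih (p + 1) q (by omega) (by omega)
    rwa [show p + 1 + q = p + (q + 1) by omega] at this

lemma choose_le_balanced (e t : ℕ) :
    (t + e).choose e ≤ (t / 2 + e).choose e * (t - t / 2 + e).choose e ∧
    (1 ≤ e → 2 ≤ t →
      (t + e).choose e < (t / 2 + e).choose e * (t - t / 2 + e).choose e) := by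
  constructor
  · have := choose_mul_choose_le_balanced e 0 t (Nat.zero_le t)
    simpa using this
  · intro he ht
    obtain ⟨s, rfl⟩ : ∃ s, t = s + 1 := ⟨t - 1, by omega⟩
    have h1 := (choose_mul_choose_le e 0 s (Nat.zero_le s)).2 he (by omega)
    have h2 := choose_mul_choose_le_balanced e 1 s (by omega)
    simp only [zero_add, Nat.choose_self, one_mul] at h1
    rw [add_comm 1 s] at h2
    exact h1.trans_le h2

end ComplexDesign

theorem mainTheorem7 (d : ℕ) (hd : 1 ≤ d) :
    -- nonnegative potentials, the bound for designs, and the case of equality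
    (∀ E : Finset (ℕ × ℕ), E.Nonempty →
      (∀ z : ℂ, ((‖ComplexDesign.gegenbauerSum d E z‖ ^ 2 : ℝ) : ℂ) =
        ComplexDesign.gegenbauerSum d E z *
          ComplexDesign.gegenbauerSum d (ComplexDesign.rev E) z) ∧
      (∃ τ ⊆ ComplexDesign.setMul E (ComplexDesign.rev E),
        ComplexDesign.IsPotential d
          (fun z => ((‖ComplexDesign.gegenbauerSum d E z‖ ^ 2 : ℝ) : ℂ)) τ) ∧
      (3 ≤ d → ComplexDesign.IsPotential d
        (fun z => ((‖ComplexDesign.gegenbauerSum d E z‖ ^ 2 : ℝ) : ℂ))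
        (ComplexDesign.setMul E (ComplexDesign.rev E))) ∧
      Module.finrank ℂ (ComplexDesign.polySpace d E) =
        ∑ i ∈ E, Module.finrank ℂ (ComplexDesign.Harm d i.1 i.2) ∧
      ∀ (n : ℕ) (v : Fin n → ComplexDesign.Sphere d),
        ComplexDesign.IsDesign
          (ComplexDesign.polySpace d (ComplexDesign.setMul E (ComplexDesign.rev E))) v →
        (∑ i ∈ E, Module.finrank ℂ (ComplexDesign.Harm d i.1 i.2) ≤ n) ∧
        ((2 ≤ d ∨ ∃ i ∈ E, i.1 = 0 ∨ i.2 = 0) →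
          (n = ∑ i ∈ E, Module.finrank ℂ (ComplexDesign.Harm d i.1 i.2) ↔
            Function.Injective v ∧
              ∀ α ∈ ComplexDesign.angles v, ComplexDesign.gegenbauerSum d E α = 0))) ∧
    -- the dimension of `Hom(p,q)`
    (∀ p q : ℕ,
      ∑ j ∈ Finset.range (min p q + 1),
          Module.finrank ℂ (ComplexDesign.Harm d (p - j) (q - j)) =
        Module.finrank ℂ (ComplexDesign.Hom d p q) ∧
      Module.finrank ℂ (ComplexDesign.Hom d p q) =
        (p + d - 1).choose (d - 1) * (q + d - 1).choose (d - 1)) ∧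
    -- the bounds for spherical `(t,t)`-designs
    (∀ (t n : ℕ) (v : Fin n → ComplexDesign.Sphere d),
      ComplexDesign.IsDesign (ComplexDesign.projSpace d t) v →
      (∀ p q : ℕ, p + q = t →
        (p + d - 1).choose (d - 1) * (q + d - 1).choose (d - 1) ≤ n) ∧
      (∀ k : ℕ, t = 2 * k → (k + d - 1).choose (d - 1) ^ 2 ≤ n) ∧
      (∀ k : ℕ, t = 2 * k + 1 →
        (k + d - 1).choose (d - 1) * (k + d).choose (d - 1) ≤ n)) ∧
    -- the choice `p = ⌊t/2⌋` is the best one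
    (∀ p q : ℕ,
      (p + d - 1).choose (d - 1) * (q + d - 1).choose (d - 1) ≤
        ((p + q) / 2 + d - 1).choose (d - 1) *
          ((p + q) - (p + q) / 2 + d - 1).choose (d - 1)) ∧
    -- the improvement on the bound `(t+d-1).choose (d-1)`
    (∀ k : ℕ,
      (2 * k + d - 1).choose (d - 1) ≤ (k + d - 1).choose (d - 1) ^ 2 ∧
      (2 * k + 1 + d - 1).choose (d - 1) ≤
        (k + d - 1).choose (d - 1) * (k + d).choose (d - 1) ∧
      (2 ≤ d → 1 ≤ k →
        (2 * k + d - 1).choose (d - 1) < (k + d - 1).choose (d - 1) ^ 2 ∧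
        (2 * k + 1 + d - 1).choose (d - 1) <
          (k + d - 1).choose (d - 1) * (k + d).choose (d - 1))) := by
  refine ⟨fun E hE => ⟨ComplexDesign.norm_gegenbauerSum_sq E, ?_, fun h3 => ?_,
      ComplexDesign.finrank_polySpace hd E, fun n v hv => ?_⟩,
    fun p q => ⟨ComplexDesign.sum_finrank_Harm hd p q, ComplexDesign.finrank_Hom hd p q⟩,
    ?_, ?_, ?_⟩
  · obtain ⟨F, h0, hz, hF, -⟩ := ComplexDesign.exists_potential hd E
    exact ⟨_, Finset.filter_subset _ _, ComplexDesign.isPotential_of_expansion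
      (G := fun z => ((‖ComplexDesign.gegenbauerSum d E z‖ ^ 2 : ℝ) : ℂ)) h0 hz hF⟩
  · obtain ⟨F, h0, hz, hF, hpos⟩ := ComplexDesign.exists_potential hd E
    have := ComplexDesign.isPotential_of_expansion
      (G := fun z => ((‖ComplexDesign.gegenbauerSum d E z‖ ^ 2 : ℝ) : ℂ)) h0 hz hF
    rwa [Finset.filter_true_of_mem (hpos h3)] at this
  · obtain ⟨hle, hiff⟩ := hv.le_and_eq_iff hd
    refine ⟨hle, fun h => hiff ?_⟩
    obtain ⟨i, hi, hd'⟩ : ∃ i ∈ E, 2 ≤ d ∨ i.1 = 0 ∨ i.2 = 0 := by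
      rcases h with h | ⟨i, hi, h⟩
      · obtain ⟨i, hi⟩ := hE
        exact ⟨i, hi, Or.inl h⟩
      · exact ⟨i, hi, Or.inr h⟩
    exact Finset.sum_pos' (fun _ _ => Nat.zero_le _) ⟨i, hi, ComplexDesign.finrank_Harm_pos hd hd'⟩
  · intro t n v hv
    have hbound : ∀ p q : ℕ, p + q = t →
        (p + d - 1).choose (d - 1) * (q + d - 1).choose (d - 1) ≤ n := by
      rintro p q rfl
      rw [← ComplexDesign.finrank_Hom hd]
      exact hv.finrank_Hom_le
    refine ⟨hbound, fun k hk => ?_, fun k hk => ?_⟩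
    · rw [sq]
      exact hbound k k (by omega)
    · have := hbound k (k + 1) (by omega)
      rwa [show k + 1 + d - 1 = k + d by omega] at this
  · intro p q
    simp only [Nat.add_sub_assoc hd]
    rcases le_total p q with h | h
    · exact ComplexDesign.choose_mul_choose_le_balanced (d - 1) p q h
    · have := ComplexDesign.choose_mul_choose_le_balanced (d - 1) q p h
      rwa [mul_comm, add_comm q p] at this
  · intro k
    have h1 := ComplexDesign.choose_le_balanced (d - 1) (2 * k)
    have h2 := ComplexDesign.choose_le_balanced (d - 1) (2 * k + 1)
    rw [show 2 * k / 2 = k by omega, show 2 * k - k = k by omega, ← sq] at h1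
    rw [show (2 * k + 1) / 2 = k by omega, show 2 * k + 1 - k + (d - 1) = k + d by omega] at h2
    simp only [Nat.add_sub_assoc hd]
    exact ⟨h1.1, h2.1, fun hd2 hk => ⟨h1.2 (by omega) (by omega), h2.2 (by omega) (by omega)⟩⟩
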